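/- For $d\ge 1$ and $a,b\in\mathbf R$ let $$H_{(a,b)}(\mathbf R^d)=\{u\in\mathcal S'(\mathbf R^d):\ \langle x\rangle^a\langle D\rangle^b u\in L^2(\mathbf R^d)\},\qquad \|u\|_{(a,b)}=\|\langle x\rangle^a\langle D\rangle^b u\|_{L^2(\mathbf R^d)},$$ where $\langle x\rangle=(1+|x|^2)^{1/2}$ and $\langle D\rangle^b$, with $D=-\mathrm i\,\partial$, is the Fourier multiplier with symbol $(1+|\xi|^2)^{b/2}$. Let $n\ge 1$ be odd, and let $K:\mathcal S'(\mathbf R^n)\to\mathcal S'(\mathbf R^{n+1})$ be the linear operator $$(Ku)(x,t)=Y_+(t)\,\cos(t|D|)u(x),\qquad x\in\mathbf R^n,\ t\in\mathbf R,$$ where $Y_+$ is the characteristic function of $[0,\infty)$ and $\cos(t|D|)$ is the Fourier multiplier with symbol $\cos(t|\xi|)$; that is, $$\langle Ku,\varphi\rangle=\int_0^\infty\langle\cos(t|D|)u,\varphi(\cdot,t)\rangle\,dt,\qquad \varphi\in\mathcal S(\mathbf R^{n+1}).$$ Assume $a<0$ and $b\le 0$. Then $K$ maps $H_{(a,b)}(\mathbf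 R^n)$ into $H_{(a-1/2,b)}(\mathbf R^{n+1})$ and is continuous between these spaces. -/

import Mathlib

open scoped SchwartzMap FourierTransform ContDiff
open MeasureTheory

namespace WaveK
noncomputable section

/-! ### The symbol of the wave propagator has temperate growth -/

/-- `cos`, followed by the functions `s ↦ ∫₀¹ (1 - r²)ᵏ cos (r s) dr`. -/
def besselCos : ℕ → ℝ → ℝ
  | 0, s => Real.cos s
  | k + 1, s => ∫ r in (0 : ℝ)..1, (1 - r ^ 2) ^ k * Real.cos (r * s)

theorem abs_besselCos_le (k : ℕ) (s : ℝ) : |besselCos k s| ≤ 1 := by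
  cases k with
  | zero => exact Real.abs_cos_le_one s
  | succ k =>
    have := intervalIntegral.norm_integral_le_of_norm_le_const (a := (0 : ℝ)) (b := 1)
      (f := fun r => (1 - r ^ 2) ^ k * Real.cos (r * s)) (C := 1) (by
        intro r hr
        rw [Set.uIoc_of_le zero_le_one] at hr
        rw [norm_mul, norm_pow, Real.norm_eq_abs, Real.norm_eq_abs]
        have h1 : |1 - r ^ 2| ≤ 1 := by
          rw [abs_le]; constructor <;> nlinarith [hr.1, hr.2]
        exact mul_le_one₀ (pow_le_one₀ (abs_nonneg _) h1) (abs_nonneg _) (Real.abs_cos_le_one _))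
    simpa [besselCos] using this

theorem hasDerivAt_besselCos_aux (k : ℕ) (s : ℝ) :
    HasDerivAt (besselCos (k + 1))
      (∫ r in (0 : ℝ)..1, (1 - r ^ 2) ^ k * (-Real.sin (r * s) * r)) s := by
  refine (intervalIntegral.hasDerivAt_integral_of_dominated_loc_of_deriv_le
    (μ := volume) (a := 0) (b := 1) (x₀ := s)
    (F' := fun s r => (1 - r ^ 2) ^ k * (-Real.sin (r * s) * r))
    (F := fun s r => (1 - r ^ 2) ^ k * Real.cos (r * s)) (bound := fun _ => 1)
    (s := Set.univ) Filter.univ_mem ?_ ?_ ?_ ?_ ?_ ?_).2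
  · refine Filter.Eventually.of_forall fun x => ?_
    exact (by fun_prop : Continuous _).aestronglyMeasurable
  · exact (by fun_prop : Continuous _).intervalIntegrable _ _
  · exact (by fun_prop : Continuous _).aestronglyMeasurable
  · refine Filter.Eventually.of_forall fun r hr x _ => ?_
    rw [Set.uIoc_of_le zero_le_one] at hr
    rw [norm_mul, norm_pow, norm_mul, norm_neg, Real.norm_eq_abs, Real.norm_eq_abs,
      Real.norm_eq_abs]
    have h1 : |1 - r ^ 2| ≤ 1 := by
      rw [abs_le]; constructor <;> nlinarith [hr.1, hr.2]
    have h2 : |r| ≤ 1 := by rw [abs_le]; constructor <;> linarith [hr.1, hr.2]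
    exact mul_le_one₀ (pow_le_one₀ (abs_nonneg _) h1) (by positivity)
      (mul_le_one₀ (Real.abs_sin_le_one _) (abs_nonneg _) h2)
  · exact intervalIntegrable_const
  · refine Filter.Eventually.of_forall fun r hr x _ => ?_
    have h : HasDerivAt (fun y => r * y) r x := by simpa using (hasDerivAt_id x).const_mul r
    exact (h.cos).const_mul _

/-- The coefficient in the recursion `f_k' (s) = c_k s f_{k+1} (s)` of the sequence `besselCos`. -/
def besselCoeff : ℕ → ℝ
  | 0 => -1
  | k + 1 => -(1 / (2 * (k + 1)))

theorem hasDerivAt_besselCos (k : ℕ) (s : ℝ) :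
    HasDerivAt (besselCos k) (besselCoeff k * (s * besselCos (k + 1) s)) s := by
  cases k with
  | zero =>
    have h : s * besselCos 1 s = Real.sin s := by
      have := intervalIntegral.mul_integral_comp_mul_right (f := Real.cos) (a := 0) (b := 1) (c := s)
      simp only [besselCos, pow_zero, one_mul]
      rw [this]; simp
    simp only [besselCoeff, zero_add, h, neg_mul, one_mul]
    exact Real.hasDerivAt_cos s
  | succ k =>
    convert hasDerivAt_besselCos_aux k s using 1
    have key := intervalIntegral.integral_mul_deriv_eq_deriv_mul (a := (0 : ℝ)) (b := 1)
      (u := fun r => Real.sin (r * s)) (u' := fun r => Real.cos (r * s) * s)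
      (v := fun r => (1 / (2 * ((k : ℝ) + 1))) * (1 - r ^ 2) ^ (k + 1))
      (v' := fun r => -r * (1 - r ^ 2) ^ k)
      (fun r _ => by
        have h : HasDerivAt (fun y => y * s) s r := by simpa using (hasDerivAt_id r).mul_const s
        exact h.sin)
      (fun r _ => by
        have h : HasDerivAt (fun y : ℝ => 1 - y ^ 2) (-(2 * r)) r := by
          simpa using (hasDerivAt_pow 2 r).const_sub 1
        have h2 := (h.pow (k + 1)).const_mul (1 / (2 * ((k : ℝ) + 1)))
        refine HasDerivAt.congr_deriv h2 ?_
        have : (k : ℝ) + 1 ≠ 0 := by positivity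
        rw [Nat.add_sub_cancel]
        push_cast
        field_simp)
      ((by fun_prop : Continuous _).intervalIntegrable _ _)
      ((by fun_prop : Continuous _).intervalIntegrable _ _)
    simp only [besselCoeff, besselCos]
    have e1 : (∫ r in (0 : ℝ)..1, (1 - r ^ 2) ^ k * (-Real.sin (r * s) * r))
        = ∫ r in (0 : ℝ)..1, Real.sin (r * s) * (-r * (1 - r ^ 2) ^ k) := by
      congr 1; ext r; ring
    rw [e1, key]
    have e2 : (∫ r in (0 : ℝ)..1, Real.cos (r * s) * s *
          (1 / (2 * ((k : ℝ) + 1)) * (1 - r ^ 2) ^ (k + 1)))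
        = (1 / (2 * ((k : ℝ) + 1)) * s) * ∫ r in (0 : ℝ)..1,
          (1 - r ^ 2) ^ (k + 1) * Real.cos (r * s) := by
      rw [← intervalIntegral.integral_const_mul]; congr 1; ext r; ring
    rw [e2]
    simp
    ring

section norm

variable {E : Type*} [NormedAddCommGroup E] [InnerProductSpace ℝ E]

theorem hasFDerivAt_besselCos_norm (k : ℕ) (x : E) :
    HasFDerivAt (fun x : E => besselCos k ‖x‖)
      ((besselCoeff k * besselCos (k + 1) ‖x‖) • innerSL ℝ x) x := by
  rcases eq_or_ne x 0 with rfl | hx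
  · have h := hasDerivAt_besselCos k 0
    rw [hasDerivAt_iff_isLittleO] at h
    rw [hasFDerivAt_iff_isLittleO]
    have ht : Filter.Tendsto (fun x : E => ‖x‖) (nhds 0) (nhds 0) := by
      simpa using (continuous_norm (E := E)).tendsto 0
    have := h.comp_tendsto ht
    refine Asymptotics.IsLittleO.of_norm_right ?_
    simpa [Function.comp_def] using this
  · have hx' : ‖x‖ ≠ 0 := by simpa using hx
    have h0 : HasFDerivAt (fun y : E => √(‖y‖ ^ 2)) ((1 / (2 * √(‖x‖ ^ 2))) • (2 • innerSL ℝ x)) x :=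
      ((hasStrictFDerivAt_norm_sq x).hasFDerivAt).sqrt (by positivity)
    simp only [Real.sqrt_sq (norm_nonneg _)] at h0
    have h := (hasDerivAt_besselCos k ‖x‖).comp_hasFDerivAt x h0
    refine HasFDerivAt.congr_fderiv h ?_
    ext y
    simp
    field_simp

theorem contDiff_besselCos_norm (m k : ℕ) : ContDiff ℝ m (fun x : E => besselCos k ‖x‖) := by
  induction m generalizing k with
  | zero =>
    exact contDiff_zero.2 (continuous_iff_continuousAt.2 fun x =>
      (hasFDerivAt_besselCos_norm k x).continuousAt)
  | succ m ih =>
    have hf : fderiv ℝ (fun x : E => besselCos k ‖x‖)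
        = fun x => (besselCoeff k * besselCos (k + 1) ‖x‖) • innerSL ℝ x :=
      funext fun x => (hasFDerivAt_besselCos_norm k x).fderiv
    rw [Nat.cast_succ, contDiff_succ_iff_fderiv]
    refine ⟨fun x => (hasFDerivAt_besselCos_norm k x).differentiableAt, by simp, ?_⟩
    rw [hf]
    exact (contDiff_const.mul (ih (k + 1))).smul (innerSL ℝ).contDiff

theorem norm_iteratedFDeriv_besselCos_norm_le (m k : ℕ) :
    ∃ (N : ℕ) (C : ℝ), 0 ≤ C ∧ ∀ j ≤ m, ∀ x : E,
      ‖iteratedFDeriv ℝ j (fun x : E => besselCos k ‖x‖) x‖ ≤ C * (1 + ‖x‖) ^ N := by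
  induction m generalizing k with
  | zero =>
    refine ⟨0, 1, zero_le_one, fun j hj x => ?_⟩
    obtain rfl : j = 0 := by omega
    simpa using abs_besselCos_le k ‖x‖
  | succ m ih =>
    obtain ⟨N, C, hC, h⟩ := ih (k + 1)
    obtain ⟨N₂, C₂, hC₂, h₂⟩ :=
      ((innerSL ℝ : E →L[ℝ] E →L[ℝ] ℝ).hasTemperateGrowth).norm_iteratedFDeriv_le_uniform m
    have hf : fderiv ℝ (fun x : E => besselCos k ‖x‖)
        = besselCoeff k • fun x : E => besselCos (k + 1) ‖x‖ • innerSL ℝ x :=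
      funext fun x => by
        rw [(hasFDerivAt_besselCos_norm k x).fderiv, mul_smul]; rfl
    have hsm : ContDiff ℝ m (fun x : E => besselCos (k + 1) ‖x‖ • innerSL ℝ x) :=
      (contDiff_besselCos_norm m (k + 1)).smul (innerSL ℝ).contDiff
    refine ⟨N + N₂, 1 + |besselCoeff k| * (2 ^ m * (C * C₂)), by positivity, fun j hj x => ?_⟩
    have h1 : (1 : ℝ) ≤ (1 + ‖x‖) ^ (N + N₂) := one_le_pow₀ (by simp)
    rcases j with _ | j
    · have := abs_besselCos_le k ‖x‖
      rw [norm_iteratedFDeriv_zero, Real.norm_eq_abs]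
      have h3 : 0 ≤ |besselCoeff k| * (2 ^ m * (C * C₂)) := by positivity
      nlinarith
    · have hj' : j ≤ m := by omega
      rw [← norm_iteratedFDeriv_fderiv, hf,
        iteratedFDeriv_const_smul_apply (hsm.of_le (mod_cast hj')).contDiffAt, norm_smul,
        Real.norm_eq_abs]
      have h4 : ‖iteratedFDeriv ℝ j (fun x : E => besselCos (k + 1) ‖x‖ • innerSL ℝ x) x‖
          ≤ 2 ^ m * (C * C₂) * (1 + ‖x‖) ^ (N + N₂) := by
        refine (norm_iteratedFDeriv_smul_le (contDiff_besselCos_norm j (k + 1))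
          (innerSL ℝ : E →L[ℝ] E →L[ℝ] ℝ).contDiff x le_rfl).trans ?_
        calc _ ≤ ∑ i ∈ Finset.range (j + 1), (j.choose i : ℝ) * (C * C₂ * (1 + ‖x‖) ^ (N + N₂)) := by
              refine Finset.sum_le_sum fun i hi => ?_
              rw [Finset.mem_range] at hi
              have e1 := h i (by omega) x
              have e2 := h₂ (j - i) (by omega) x
              rw [mul_assoc, pow_add]
              refine mul_le_mul_of_nonneg_left ?_ (by positivity)
              calc _ ≤ (C * (1 + ‖x‖) ^ N) * (C₂ * (1 + ‖x‖) ^ N₂) := by gcongr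
                _ = _ := by ring
          _ = 2 ^ j * (C * C₂ * (1 + ‖x‖) ^ (N + N₂)) := by
              rw [← Finset.sum_mul]; congr 1; exact_mod_cast Nat.sum_range_choose j
          _ ≤ 2 ^ m * (C * C₂ * (1 + ‖x‖) ^ (N + N₂)) := by
              gcongr; norm_num
          _ = _ := by ring
      calc _ ≤ |besselCoeff k| * (2 ^ m * (C * C₂) * (1 + ‖x‖) ^ (N + N₂)) := by gcongr
        _ = |besselCoeff k| * (2 ^ m * (C * C₂)) * (1 + ‖x‖) ^ (N + N₂) := by ring
        _ ≤ _ := by gcongr; linarith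

variable (E) in
theorem hasTemperateGrowth_cos_norm :
    Function.HasTemperateGrowth (fun x : E => ((Real.cos ‖x‖ : ℝ) : ℂ)) := by
  have h : Function.HasTemperateGrowth (fun x : E => Real.cos ‖x‖) := by
    refine ⟨contDiff_infty.2 fun m => contDiff_besselCos_norm m 0, fun m => ?_⟩
    obtain ⟨N, C, -, h⟩ := norm_iteratedFDeriv_besselCos_norm_le (E := E) m 0
    exact ⟨N, C, h m le_rfl⟩
  exact Function.Complex.hasTemperateGrowth_ofReal.comp h

end norm

/-! ### Families of operators on Schwartz functions with polynomial bounds -/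

section bounds

variable {E V : Type*} [NormedAddCommGroup E] [NormedSpace ℝ E]
  [NormedAddCommGroup V] [NormedSpace ℝ V]

/-- The operators `T τ` are bounded by `b τ` times a power of `W τ`, in every Schwartz seminorm. -/
def PolyBounded {ι : Type*} (b W : ι → ℝ) (T : ι → 𝓢(V, ℂ) → 𝓢(E, ℂ)) : Prop :=
  ∀ i : ℕ × ℕ, ∃ (N : ℕ) (C : ℝ) (s : Finset (ℕ × ℕ)), 0 ≤ C ∧ ∀ τ g,
    schwartzSeminormFamily ℂ E ℂ i (T τ g)
      ≤ b τ * (C * W τ ^ N * s.sup (schwartzSeminormFamily ℂ V ℂ) g)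

theorem PolyBounded.sup {ι : Type*} {b W : ι → ℝ} {T : ι → 𝓢(V, ℂ) → 𝓢(E, ℂ)}
    (h : PolyBounded b W T) (hb : ∀ τ, 0 ≤ b τ) (hW : ∀ τ, 1 ≤ W τ) (s : Finset (ℕ × ℕ)) :
    ∃ (N : ℕ) (C : ℝ) (s' : Finset (ℕ × ℕ)), 0 ≤ C ∧ ∀ τ g,
      s.sup (schwartzSeminormFamily ℂ E ℂ) (T τ g)
        ≤ b τ * (C * W τ ^ N * s'.sup (schwartzSeminormFamily ℂ V ℂ) g) := by
  choose N C s' hC h using h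
  refine ⟨s.sup N, ∑ i ∈ s, C i, s.biUnion s', Finset.sum_nonneg fun i _ => hC i, fun τ g => ?_⟩
  have hW0 : 0 ≤ W τ := zero_le_one.trans (hW τ)
  have hS : 0 ≤ ∑ i ∈ s, C i := Finset.sum_nonneg fun i _ => hC i
  refine Seminorm.finset_sup_apply_le (mul_nonneg (hb τ)
    (mul_nonneg (mul_nonneg hS (pow_nonneg hW0 _)) (apply_nonneg _ _))) fun i hi => ?_
  refine (h i τ g).trans ?_
  refine mul_le_mul_of_nonneg_left ?_ (hb τ)
  refine mul_le_mul (mul_le_mul ?_ ?_ (pow_nonneg hW0 _) hS) ?_ (apply_nonneg _ _)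
    (mul_nonneg hS (pow_nonneg hW0 _))
  · exact Finset.single_le_sum (f := C) (fun i _ => hC i) hi
  · exact pow_le_pow_right₀ (hW τ) (Finset.le_sup hi)
  · exact Finset.sup_mono (f := schwartzSeminormFamily ℂ V ℂ)
      (Finset.subset_biUnion_of_mem s' hi) g

theorem exists_bound_functional (w : 𝓢(E, ℂ) →L[ℂ] ℂ) :
    ∃ (s : Finset (ℕ × ℕ)) (C : ℝ), 0 ≤ C ∧ ∀ g,
      ‖w g‖ ≤ C * s.sup (schwartzSeminormFamily ℂ E ℂ) g := by
  obtain ⟨s, C, -, h⟩ := Seminorm.bound_of_continuous (schwartz_withSeminorms ℂ E ℂ)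
    ((normSeminorm ℂ ℂ).comp w.toLinearMap) (by exact w.continuous.norm)
  exact ⟨s, C, C.2, fun g => h g⟩

theorem continuous_sup_seminorm (s : Finset (ℕ × ℕ)) :
    Continuous fun g : 𝓢(E, ℂ) => s.sup (schwartzSeminormFamily ℂ E ℂ) g := by
  induction s using Finset.induction_on with
  | empty => simpa [Seminorm.bot_eq_zero] using (continuous_const : Continuous fun _ => (0 : ℝ))
  | insert i s _ ih =>
    simp only [Finset.sup_insert, Seminorm.sup_apply]
    exact ((schwartz_withSeminorms ℂ E ℂ).continuous_seminorm i).max ih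

theorem exists_bound_clm (T : 𝓢(V, ℂ) →L[ℂ] 𝓢(E, ℂ)) (s : Finset (ℕ × ℕ)) :
    ∃ (s' : Finset (ℕ × ℕ)) (C : ℝ), 0 ≤ C ∧ ∀ g,
      s.sup (schwartzSeminormFamily ℂ E ℂ) (T g)
        ≤ C * s'.sup (schwartzSeminormFamily ℂ V ℂ) g := by
  obtain ⟨s', C, -, h⟩ := Seminorm.bound_of_continuous (schwartz_withSeminorms ℂ V ℂ)
    ((s.sup (schwartzSeminormFamily ℂ E ℂ)).comp T.toLinearMap) (by
      exact (continuous_sup_seminorm s).comp T.continuous)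
  exact ⟨s', C, C.2, fun g => h g⟩

theorem seminorm_smulLeftCLM_le {a : E → ℂ} (ha : a.HasTemperateGrowth) {A : ℝ} (hA : 0 ≤ A)
    {N l : ℕ} (k : ℕ) (h : ∀ j ≤ l, ∀ x, ‖iteratedFDeriv ℝ j a x‖ ≤ A * (1 + ‖x‖) ^ N)
    (g : 𝓢(E, ℂ)) :
    schwartzSeminormFamily ℂ E ℂ (k, l) (SchwartzMap.smulLeftCLM ℂ a g)
      ≤ A * (2 ^ l * 2 ^ (k + N)
        * (Finset.Iic (k + N, l)).sup (schwartzSeminormFamily ℂ E ℂ) g) := by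
  set S := (Finset.Iic (k + N, l)).sup (schwartzSeminormFamily ℂ E ℂ) g with hS
  have hS0 : 0 ≤ S := apply_nonneg _ _
  refine SchwartzMap.seminorm_le_bound ℂ k l _ (by positivity) fun x => ?_
  rw [SchwartzMap.smulLeftCLM_apply ha]
  have h1 : ‖iteratedFDeriv ℝ l (fun x => a x • g x) x‖
      ≤ ∑ i ∈ Finset.range (l + 1), (l.choose i : ℝ) * ‖iteratedFDeriv ℝ i a x‖
        * ‖iteratedFDeriv ℝ (l - i) g x‖ :=
    norm_iteratedFDeriv_smul_le (ha.1.of_le (mod_cast le_top)) (g.smooth l) x le_rfl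
  calc _ ≤ (1 + ‖x‖) ^ k * ∑ i ∈ Finset.range (l + 1), (l.choose i : ℝ)
        * ‖iteratedFDeriv ℝ i a x‖ * ‖iteratedFDeriv ℝ (l - i) g x‖ := by
        gcongr; linarith
    _ = ∑ i ∈ Finset.range (l + 1), (l.choose i : ℝ) * ((1 + ‖x‖) ^ k
        * ‖iteratedFDeriv ℝ i a x‖ * ‖iteratedFDeriv ℝ (l - i) g x‖) := by
        rw [Finset.mul_sum]; exact Finset.sum_congr rfl fun i _ => by ring
    _ ≤ ∑ i ∈ Finset.range (l + 1), (l.choose i : ℝ) * (A * (2 ^ (k + N) * S)) := by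
        refine Finset.sum_le_sum fun i hi => mul_le_mul_of_nonneg_left ?_ (by positivity)
        rw [Finset.mem_range] at hi
        have h2 := SchwartzMap.one_add_le_sup_seminorm_apply (𝕜 := ℂ) (m := (k + N, l))
          (k := k + N) (n := l - i) le_rfl (Nat.sub_le _ _) g x
        calc _ ≤ (1 + ‖x‖) ^ k * (A * (1 + ‖x‖) ^ N) * ‖iteratedFDeriv ℝ (l - i) g x‖ := by
              gcongr; exact h i (by omega) x
          _ = A * ((1 + ‖x‖) ^ (k + N) * ‖iteratedFDeriv ℝ (l - i) g x‖) := by ring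
          _ ≤ _ := mul_le_mul_of_nonneg_left h2 hA
    _ = 2 ^ l * (A * (2 ^ (k + N) * S)) := by
        rw [← Finset.sum_mul]; congr 1; exact_mod_cast Nat.sum_range_choose l
    _ = _ := by ring

theorem iteratedFDeriv_slice {F : Type*} [NormedAddCommGroup F] [NormedSpace ℝ F] {f : V → F}
    (hf : ContDiff ℝ ∞ f) (L : E →L[ℝ] V) (v : V) (l : ℕ) (x : E) :
    iteratedFDeriv ℝ l (fun x => f (L x + v)) x
      = (iteratedFDeriv ℝ l f (L x + v)).compContinuousLinearMap fun _ => L := by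
  have h1 : ContDiff ℝ l (fun y => f (y + v)) :=
    (hf.of_le (mod_cast le_top)).comp (contDiff_id.add contDiff_const)
  have h2 := L.iteratedFDeriv_comp_right h1 x le_rfl
  rw [iteratedFDeriv_comp_add_right] at h2
  exact h2

theorem norm_compContinuousLinearMap_le_of_le_one {F : Type*} [NormedAddCommGroup F]
    [NormedSpace ℝ F] {l : ℕ} (m : V [×l]→L[ℝ] F) {L : E →L[ℝ] V} (hL : ‖L‖ ≤ 1) :
    ‖m.compContinuousLinearMap fun _ => L‖ ≤ ‖m‖ := by
  refine (m.norm_compContinuousLinearMap_le _).trans ?_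
  rw [Finset.prod_const]
  exact mul_le_of_le_one_right (norm_nonneg _) (pow_le_one₀ (norm_nonneg _) hL)

theorem norm_iteratedFDeriv_slice_le {F : Type*} [NormedAddCommGroup F] [NormedSpace ℝ F]
    {f : V → F} (hf : ContDiff ℝ ∞ f) {L : E →L[ℝ] V} (hL : ‖L‖ ≤ 1) (v : V) (l : ℕ) (x : E) :
    ‖iteratedFDeriv ℝ l (fun x => f (L x + v)) x‖ ≤ ‖iteratedFDeriv ℝ l f (L x + v)‖ := by
  rw [iteratedFDeriv_slice hf]
  exact norm_compContinuousLinearMap_le_of_le_one _ hL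

theorem norm_iteratedFDeriv_slice_sub_le {F : Type*} [NormedAddCommGroup F] [NormedSpace ℝ F]
    {f : V → F} (hf : ContDiff ℝ ∞ f) {L : E →L[ℝ] V} (hL : ‖L‖ ≤ 1) {e : V} (he : ‖e‖ ≤ 1)
    (t r : ℝ) (l : ℕ) (x : E) {C : ℝ}
    (hC : ∀ q ∈ segment ℝ r t, ‖iteratedFDeriv ℝ (l + 1) f (L x + q • e)‖ ≤ C) :
    ‖iteratedFDeriv ℝ l (fun x => f (L x + t • e) - f (L x + r • e)) x‖ ≤ C * |t - r| := by
  have hs : ∀ v : V, ContDiff ℝ l (fun x => f (L x + v)) := fun v =>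
    (hf.of_le (mod_cast le_top)).comp (L.contDiff.add contDiff_const)
  rw [fun_iteratedFDeriv_sub_apply (hs _).contDiffAt (hs _).contDiffAt, iteratedFDeriv_slice hf,
    iteratedFDeriv_slice hf]
  have h1 : (iteratedFDeriv ℝ l f (L x + t • e)).compContinuousLinearMap (fun _ => L)
      - (iteratedFDeriv ℝ l f (L x + r • e)).compContinuousLinearMap (fun _ => L)
      = (iteratedFDeriv ℝ l f (L x + t • e)
        - iteratedFDeriv ℝ l f (L x + r • e)).compContinuousLinearMap (fun _ => L) := by
    ext; simp
  rw [h1]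
  refine (norm_compContinuousLinearMap_le_of_le_one _ hL).trans ?_
  have hC0 : 0 ≤ C := (norm_nonneg _).trans (hC r (left_mem_segment ℝ r t))
  have hd : Differentiable ℝ (iteratedFDeriv ℝ l f) :=
    hf.differentiable_iteratedFDeriv (mod_cast WithTop.coe_lt_top _)
  have h2 := (convex_segment (𝕜 := ℝ) r t).norm_image_sub_le_of_norm_hasDerivWithin_le
    (f := fun q => iteratedFDeriv ℝ l f (L x + q • e))
    (f' := fun q => fderiv ℝ (iteratedFDeriv ℝ l f) (L x + q • e) e) (C := C)
    (fun q _ => by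
      have h3 : HasDerivAt (fun q : ℝ => L x + q • e) e q := by
        simpa using ((hasDerivAt_id q).smul_const e).const_add (L x)
      exact ((hd _).hasFDerivAt.comp_hasDerivAt q h3).hasDerivWithinAt)
    (fun q hq => by
      refine (ContinuousLinearMap.le_opNorm _ _).trans ?_
      rw [norm_fderiv_iteratedFDeriv]
      calc _ ≤ C * 1 := mul_le_mul (hC q hq) he (norm_nonneg _) hC0
        _ = C := mul_one C)
    (left_mem_segment ℝ r t) (right_mem_segment ℝ r t)
  simpa [Real.norm_eq_abs] using h2

end bounds

/-! ### Space-time coordinates and time slices -/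

section spacetime

variable {n : ℕ}

/-- The point `(x, t)` of `ℝⁿ⁺¹ = ℝⁿ × ℝ`; the time `t` is the last coordinate. -/
def spaceTime (x : EuclideanSpace ℝ (Fin n)) (t : ℝ) : EuclideanSpace ℝ (Fin (n + 1)) :=
  WithLp.toLp 2 (Fin.snoc (α := fun _ => ℝ) (fun i => x i) t)

theorem norm_sq_spaceTime (x : EuclideanSpace ℝ (Fin n)) (t : ℝ) :
    ‖spaceTime x t‖ ^ 2 = ‖x‖ ^ 2 + t ^ 2 := by
  rw [EuclideanSpace.norm_sq_eq, EuclideanSpace.norm_sq_eq, Fin.sum_univ_castSucc]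
  simp [spaceTime]

theorem norm_le_norm_spaceTime (x : EuclideanSpace ℝ (Fin n)) (t : ℝ) : ‖x‖ ≤ ‖spaceTime x t‖ :=
  (sq_le_sq₀ (norm_nonneg _) (norm_nonneg _)).1
    (by rw [norm_sq_spaceTime]; nlinarith [sq_nonneg t])

theorem abs_le_norm_spaceTime (x : EuclideanSpace ℝ (Fin n)) (t : ℝ) : |t| ≤ ‖spaceTime x t‖ :=
  (sq_le_sq₀ (abs_nonneg _) (norm_nonneg _)).1
    (by rw [norm_sq_spaceTime, sq_abs]; nlinarith [sq_nonneg ‖x‖])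

theorem norm_spaceTime_le (x : EuclideanSpace ℝ (Fin n)) (t : ℝ) :
    ‖spaceTime x t‖ ≤ ‖x‖ + |t| :=
  (sq_le_sq₀ (norm_nonneg _) (by positivity)).1 (by
    rw [norm_sq_spaceTime, ← sq_abs t]
    nlinarith [mul_nonneg (norm_nonneg x) (abs_nonneg t)])

variable (n) in
/-- The inclusion `x ↦ (x, 0)`. -/
def spaceIncl : EuclideanSpace ℝ (Fin n) →L[ℝ] EuclideanSpace ℝ (Fin (n + 1)) :=
  LinearMap.toContinuousLinearMap
    { toFun := fun x => spaceTime x 0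
      map_add' := fun x y => by
        ext i; refine Fin.lastCases ?_ (fun j => ?_) i <;> simp [spaceTime]
      map_smul' := fun c x => by
        ext i; refine Fin.lastCases ?_ (fun j => ?_) i <;> simp [spaceTime] }

variable (n) in
/-- The unit vector `(0, 1)` in the time direction. -/
def timeVec : EuclideanSpace ℝ (Fin (n + 1)) := spaceTime 0 1

variable (n) in
/-- The projection `(x, t) ↦ x`. -/
def spaceProj : EuclideanSpace ℝ (Fin (n + 1)) →L[ℝ] EuclideanSpace ℝ (Fin n) :=
  LinearMap.toContinuousLinearMap
    { toFun := fun y => WithLp.toLp 2 fun i => y i.castSucc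
      map_add' := fun x y => by ext i; simp
      map_smul' := fun c x => by ext i; simp }

theorem spaceTime_eq (x : EuclideanSpace ℝ (Fin n)) (t : ℝ) :
    spaceTime x t = spaceIncl n x + t • timeVec n := by
  ext i
  refine Fin.lastCases ?_ (fun j => ?_) i <;> simp [spaceTime, spaceIncl, timeVec]

theorem spaceProj_spaceTime (x : EuclideanSpace ℝ (Fin n)) (t : ℝ) :
    spaceProj n (spaceTime x t) = x := by
  ext i; simp [spaceProj, spaceTime]

theorem spaceTime_last (x : EuclideanSpace ℝ (Fin n)) (t : ℝ) :
    spaceTime x t (Fin.last n) = t := by simp [spaceTime]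

theorem norm_spaceIncl_le : ‖spaceIncl n‖ ≤ 1 :=
  ContinuousLinearMap.opNorm_le_bound _ zero_le_one fun x => by
    have h := norm_spaceTime_le x 0
    rw [abs_zero, add_zero] at h
    rw [one_mul]
    exact h

theorem norm_timeVec_le : ‖timeVec n‖ ≤ 1 := by
  have h := norm_spaceTime_le (0 : EuclideanSpace ℝ (Fin n)) 1
  rw [norm_zero, abs_one, zero_add] at h
  exact h

/-- The slice `x ↦ φ (x, t)` of a Schwartz function `φ` on `ℝⁿ⁺¹`. -/
def timeSlice (t : ℝ) :
    𝓢(EuclideanSpace ℝ (Fin (n + 1)), ℂ) →L[ℂ] 𝓢(EuclideanSpace ℝ (Fin n), ℂ) :=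
  SchwartzMap.compCLM ℂ (g := fun x => spaceTime x t)
    (by simp only [spaceTime_eq]; fun_prop)
    ⟨1, 1, fun x => by have := norm_le_norm_spaceTime x t; simp; linarith⟩

theorem timeSlice_apply (t : ℝ) (φ : 𝓢(EuclideanSpace ℝ (Fin (n + 1)), ℂ))
    (x : EuclideanSpace ℝ (Fin n)) : timeSlice t φ x = φ (spaceTime x t) := rfl

theorem timeSlice_polyBounded (M : ℕ) :
    PolyBounded (fun t => ((1 + |t|) ^ M)⁻¹) (fun _ => 1)
      (fun t (φ : 𝓢(EuclideanSpace ℝ (Fin (n + 1)), ℂ)) => timeSlice t φ) := by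
  rintro ⟨k, l⟩
  refine ⟨0, 2 ^ (k + M), Finset.Iic (k + M, l), by positivity, fun t φ => ?_⟩
  refine SchwartzMap.seminorm_le_bound ℂ k l _
    (mul_nonneg (by positivity) (mul_nonneg (by positivity) (apply_nonneg _ _))) fun x => ?_
  have h1 : ‖iteratedFDeriv ℝ l (timeSlice t φ) x‖ ≤ ‖iteratedFDeriv ℝ l φ (spaceTime x t)‖ := by
    have := norm_iteratedFDeriv_slice_le (φ.smooth ⊤) (norm_spaceIncl_le (n := n))
      (t • timeVec n) l x
    simp only [← spaceTime_eq] at this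
    exact this
  have h2 := SchwartzMap.one_add_le_sup_seminorm_apply (𝕜 := ℂ) (m := (k + M, l))
    (k := k + M) (n := l) le_rfl le_rfl φ (spaceTime x t)
  have h3 : (0 : ℝ) < (1 + |t|) ^ M := by positivity
  rw [one_pow, mul_one, inv_mul_eq_div, le_div_iff₀ h3]
  refine le_trans ?_ h2
  have h4 := norm_le_norm_spaceTime x t
  have h5 := abs_le_norm_spaceTime x t
  calc _ = ‖x‖ ^ k * (1 + |t|) ^ M * ‖iteratedFDeriv ℝ l (timeSlice t φ) x‖ := by ring
    _ ≤ (1 + ‖spaceTime x t‖) ^ k * (1 + ‖spaceTime x t‖) ^ M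
        * ‖iteratedFDeriv ℝ l φ (spaceTime x t)‖ := by gcongr; linarith
    _ = _ := by rw [pow_add]

theorem continuous_timeSlice (φ : 𝓢(EuclideanSpace ℝ (Fin (n + 1)), ℂ)) :
    Continuous fun t => timeSlice t φ := by
  refine continuous_iff_continuousAt.2 fun r => ?_
  refine ((schwartz_withSeminorms ℂ (EuclideanSpace ℝ (Fin n)) ℂ).tendsto_nhds _ _).2 ?_
  rintro ⟨k, l⟩ ε hε
  set S := SchwartzMap.seminorm ℂ k (l + 1) φ
  have hS : 0 ≤ S := apply_nonneg _ _
  have hlim : Filter.Tendsto (fun t : ℝ => S * |t - r|) (nhds r) (nhds 0) := by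
    have : Continuous fun t : ℝ => S * |t - r| := by fun_prop
    simpa using this.tendsto r
  filter_upwards [hlim.eventually (gt_mem_nhds hε)] with t ht
  refine lt_of_le_of_lt ?_ ht
  refine SchwartzMap.seminorm_le_bound ℂ k l _ (by positivity) fun x => ?_
  rcases eq_or_ne (‖x‖ ^ k) 0 with h0 | h0
  · rw [h0, zero_mul]; positivity
  have hx : 0 < ‖x‖ ^ k := lt_of_le_of_ne (by positivity) h0.symm
  have h := norm_iteratedFDeriv_slice_sub_le (φ.smooth ⊤) (norm_spaceIncl_le (n := n))
    (norm_timeVec_le (n := n)) t r l x (C := S / ‖x‖ ^ k) (fun q _ => by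
      rw [← spaceTime_eq, le_div_iff₀ hx, mul_comm]
      refine le_trans ?_ (φ.le_seminorm ℂ k (l + 1) (spaceTime x q))
      gcongr
      exact norm_le_norm_spaceTime x q)
  simp only [← spaceTime_eq] at h
  calc _ ≤ ‖x‖ ^ k * (S / ‖x‖ ^ k * |t - r|) := mul_le_mul_of_nonneg_left h (by positivity)
    _ = S * |t - r| := by field_simp

/-! ### The symbol of `cos (t|D|)` -/

/-- The symbol of `cos (t|D|)`. As the Fourier transform is `∫ e^{-2πi⟨x, ξ⟩} f x dx`, the operator
`|D|` is multiplication by `2π|ξ|` on the Fourier transform side. -/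
def waveSymbol (t : ℝ) (ξ : EuclideanSpace ℝ (Fin n)) : ℂ :=
  (Real.cos (t * (2 * Real.pi * ‖ξ‖)) : ℝ)

/-- The symbol of `cos (t|D|)` as a function of `(ξ, t)`. -/
def waveSymbolJoint (y : EuclideanSpace ℝ (Fin (n + 1))) : ℂ :=
  (Real.cos ‖(2 * Real.pi * y (Fin.last n)) • spaceProj n y‖ : ℝ)

theorem waveSymbolJoint_spaceTime (ξ : EuclideanSpace ℝ (Fin n)) (t : ℝ) :
    waveSymbolJoint (spaceTime ξ t) = waveSymbol t ξ := by
  have h : |2 * Real.pi * t| * ‖ξ‖ = |t * (2 * Real.pi * ‖ξ‖)| := by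
    simp only [abs_mul, abs_norm]; ring
  rw [waveSymbolJoint, waveSymbol, spaceProj_spaceTime, spaceTime_last, norm_smul,
    Real.norm_eq_abs, h, Real.cos_abs]

theorem hasTemperateGrowth_waveSymbolJoint :
    Function.HasTemperateGrowth (waveSymbolJoint (n := n)) := by
  refine (hasTemperateGrowth_cos_norm (EuclideanSpace ℝ (Fin n))).comp
    (f := fun y => (2 * Real.pi * y (Fin.last n)) • spaceProj n y) ?_
  have h1 : Function.HasTemperateGrowth
      (fun y : EuclideanSpace ℝ (Fin (n + 1)) => y (Fin.last n)) :=
    (EuclideanSpace.proj (𝕜 := ℝ) (Fin.last n)).hasTemperateGrowth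
  have h2 := (spaceProj n).hasTemperateGrowth
  have h3 : Function.HasTemperateGrowth
      (fun y : EuclideanSpace ℝ (Fin (n + 1)) => 2 * Real.pi * y (Fin.last n)) :=
    (Function.HasTemperateGrowth.const _).mul h1
  exact h3.smul h2

theorem hasTemperateGrowth_waveSymbol (t : ℝ) :
    Function.HasTemperateGrowth (waveSymbol (n := n) t) := by
  have h : waveSymbol (n := n) t = waveSymbolJoint ∘ fun ξ => spaceTime ξ t :=
    funext fun ξ => (waveSymbolJoint_spaceTime ξ t).symm
  rw [h]
  refine hasTemperateGrowth_waveSymbolJoint.comp ?_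
  simp only [spaceTime_eq]
  fun_prop

theorem one_add_norm_spaceTime_le (ξ : EuclideanSpace ℝ (Fin n)) {t R : ℝ} (h : |t| ≤ R) :
    1 + ‖spaceTime ξ t‖ ≤ (1 + ‖ξ‖) * (1 + R) := by
  have h1 := norm_spaceTime_le ξ t
  have h2 := abs_nonneg t
  nlinarith [norm_nonneg ξ, mul_nonneg (norm_nonneg ξ) (h2.trans h)]

theorem waveSymbol_polyBounded :
    PolyBounded (fun _ => 1) (fun t => 1 + |t|)
      (fun t (g : 𝓢(EuclideanSpace ℝ (Fin n), ℂ)) =>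
        SchwartzMap.smulLeftCLM ℂ (waveSymbol t) g) := by
  rintro ⟨k, l⟩
  obtain ⟨N, C, hC, h⟩ :=
    (hasTemperateGrowth_waveSymbolJoint (n := n)).norm_iteratedFDeriv_le_uniform l
  refine ⟨N, C * (2 ^ l * 2 ^ (k + N)), Finset.Iic (k + N, l), by positivity, fun t g => ?_⟩
  refine (seminorm_smulLeftCLM_le (hasTemperateGrowth_waveSymbol t)
    (A := C * (1 + |t|) ^ N) (by positivity) (N := N) k (fun j hj x => ?_) g).trans
    (le_of_eq (by ring))
  have h1 := norm_iteratedFDeriv_slice_le (hasTemperateGrowth_waveSymbolJoint (n := n)).1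
    (norm_spaceIncl_le (n := n)) (t • timeVec n) j x
  simp only [← spaceTime_eq, waveSymbolJoint_spaceTime] at h1
  calc _ ≤ C * (1 + ‖spaceTime x t‖) ^ N := h1.trans (h j hj _)
    _ ≤ C * ((1 + ‖x‖) * (1 + |t|)) ^ N := by
        gcongr; exact one_add_norm_spaceTime_le x le_rfl
    _ = _ := by rw [mul_pow]; ring

theorem waveSymbol_sub_polyBounded :
    PolyBounded (fun p : ℝ × ℝ => |p.1 - p.2|) (fun p => 1 + (|p.1| + |p.2|))
      (fun p (g : 𝓢(EuclideanSpace ℝ (Fin n), ℂ)) =>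
        SchwartzMap.smulLeftCLM ℂ (waveSymbol p.1) g
          - SchwartzMap.smulLeftCLM ℂ (waveSymbol p.2) g) := by
  rintro ⟨k, l⟩
  obtain ⟨N, C, hC, h⟩ :=
    (hasTemperateGrowth_waveSymbolJoint (n := n)).norm_iteratedFDeriv_le_uniform (l + 1)
  refine ⟨N, C * (2 ^ l * 2 ^ (k + N)), Finset.Iic (k + N, l), by positivity, ?_⟩
  rintro ⟨t, r⟩ g
  have hs : SchwartzMap.smulLeftCLM ℂ (waveSymbol t) g - SchwartzMap.smulLeftCLM ℂ (waveSymbol r) g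
      = SchwartzMap.smulLeftCLM ℂ (fun ξ => waveSymbol t ξ - waveSymbol r ξ) g := by
    ext x
    have h3 := (hasTemperateGrowth_waveSymbol (n := n) t).sub (hasTemperateGrowth_waveSymbol r)
    have h4 : Function.HasTemperateGrowth
      (fun ξ : EuclideanSpace ℝ (Fin n) => waveSymbol t ξ - waveSymbol r ξ) := h3
    simp [SchwartzMap.smulLeftCLM_apply_apply, h4, hasTemperateGrowth_waveSymbol, sub_mul]
  dsimp only
  rw [hs]
  refine (seminorm_smulLeftCLM_le
    ((hasTemperateGrowth_waveSymbol (n := n) t).sub (hasTemperateGrowth_waveSymbol r))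
    (A := C * (1 + (|t| + |r|)) ^ N * |t - r|) (by positivity) (N := N) k (fun j hj x => ?_) g).trans
    (le_of_eq (by ring))
  have h1 := norm_iteratedFDeriv_slice_sub_le (hasTemperateGrowth_waveSymbolJoint (n := n)).1
    (norm_spaceIncl_le (n := n)) (norm_timeVec_le (n := n)) t r j x
    (C := C * ((1 + ‖x‖) * (1 + (|t| + |r|))) ^ N) (fun q hq => by
      rw [← spaceTime_eq]
      refine (h (j + 1) (by omega) _).trans ?_
      gcongr
      refine one_add_norm_spaceTime_le x ?_
      rw [segment_eq_uIcc] at hq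
      rw [abs_le]
      rcases Set.mem_uIcc.1 hq with hq | hq <;> constructor <;>
        linarith [hq.1, hq.2, neg_abs_le t, neg_abs_le r, le_abs_self t, le_abs_self r])
  simp only [← spaceTime_eq, waveSymbolJoint_spaceTime] at h1
  refine h1.trans (le_of_eq ?_)
  rw [mul_pow]; ring


/-! ### The operator `K` -/

variable (n) in
/-- The operator `cos (t|D|)` on tempered distributions on `ℝⁿ`. -/
def cosD (t : ℝ) : 𝓢'(EuclideanSpace ℝ (Fin n), ℂ) →L[ℂ] 𝓢'(EuclideanSpace ℝ (Fin n), ℂ) :=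
  TemperedDistribution.fourierMultiplierCLM ℂ (waveSymbol t)

/-- `u ∘ 𝓕` as a continuous functional. -/
def fourierFunctional (u : 𝓢'(EuclideanSpace ℝ (Fin n), ℂ)) :
    𝓢(EuclideanSpace ℝ (Fin n), ℂ) →L[ℂ] ℂ where
  toFun g := u (𝓕 g)
  map_add' f g := by rw [FourierTransform.fourier_add, map_add]
  map_smul' c g := by rw [FourierTransform.fourier_smul, map_smul]; rfl
  cont := u.continuous.comp
    (FourierTransform.fourierCLM ℂ 𝓢(EuclideanSpace ℝ (Fin n), ℂ)).continuous

theorem cosD_apply (t : ℝ) (u : 𝓢'(EuclideanSpace ℝ (Fin n), ℂ))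
    (g : 𝓢(EuclideanSpace ℝ (Fin n), ℂ)) :
    cosD n t u g = fourierFunctional u (SchwartzMap.smulLeftCLM ℂ (waveSymbol t) (𝓕⁻ g)) := rfl

theorem continuous_cosD_timeSlice (u : 𝓢'(EuclideanSpace ℝ (Fin n), ℂ))
    (φ : 𝓢(EuclideanSpace ℝ (Fin (n + 1)), ℂ)) :
    Continuous fun t => cosD n t u (timeSlice t φ) := by
  simp only [cosD_apply]
  set w := fourierFunctional u
  set ψ : ℝ → 𝓢(EuclideanSpace ℝ (Fin n), ℂ) := fun t => 𝓕⁻ (timeSlice t φ) with hψ_def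
  have hψ : Continuous ψ :=
    (FourierTransform.fourierInvCLM ℂ 𝓢(EuclideanSpace ℝ (Fin n), ℂ)).continuous.comp
      (continuous_timeSlice φ)
  obtain ⟨s, C, hC, hw⟩ := exists_bound_functional w
  obtain ⟨N₁, C₁, s₁, hC₁, h₁⟩ := (waveSymbol_polyBounded (n := n)).sup
    (fun _ => zero_le_one) (fun t => by simp) s
  obtain ⟨N₂, C₂, s₂, hC₂, h₂⟩ := (waveSymbol_sub_polyBounded (n := n)).sup
    (fun _ => abs_nonneg _) (fun t => by simp; positivity) s
  refine continuous_iff_continuousAt.2 fun r => ?_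
  rw [ContinuousAt, tendsto_iff_norm_sub_tendsto_zero]
  set B : ℝ → ℝ := fun t =>
    C * (1 * (C₁ * (1 + |t|) ^ N₁
        * s₁.sup (schwartzSeminormFamily ℂ (EuclideanSpace ℝ (Fin n)) ℂ) (ψ t - ψ r)))
      + C * (|t - r| * (C₂ * (1 + (|t| + |r|)) ^ N₂
        * s₂.sup (schwartzSeminormFamily ℂ (EuclideanSpace ℝ (Fin n)) ℂ) (ψ r))) with hB
  have hBc : Continuous B := by
    have := (continuous_sup_seminorm (E := EuclideanSpace ℝ (Fin n)) s₁).comp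
      (hψ.sub continuous_const : Continuous fun t => ψ t - ψ r)
    simp only [Function.comp_def] at this
    fun_prop
  have hB0 : Filter.Tendsto B (nhds r) (nhds 0) := by
    have : B r = 0 := by simp [hB]
    simpa [this] using hBc.tendsto r
  refine squeeze_zero (fun t => norm_nonneg _) (fun t => ?_) hB0
  have e : w (SchwartzMap.smulLeftCLM ℂ (waveSymbol t) (ψ t))
        - w (SchwartzMap.smulLeftCLM ℂ (waveSymbol r) (ψ r))
      = w (SchwartzMap.smulLeftCLM ℂ (waveSymbol t) (ψ t - ψ r))
        + w (SchwartzMap.smulLeftCLM ℂ (waveSymbol t) (ψ r)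
          - SchwartzMap.smulLeftCLM ℂ (waveSymbol r) (ψ r)) := by
    simp only [map_sub]; ring
  rw [e]
  refine (norm_add_le _ _).trans (add_le_add ?_ ?_)
  · exact (hw _).trans (mul_le_mul_of_nonneg_left (h₁ t _) hC)
  · exact (hw _).trans (mul_le_mul_of_nonneg_left (h₂ (t, r) _) hC)

theorem exists_bound_cosD_timeSlice (u : 𝓢'(EuclideanSpace ℝ (Fin n), ℂ)) :
    ∃ (s : Finset (ℕ × ℕ)) (C : ℝ), 0 ≤ C ∧ ∀ (t : ℝ) (φ : 𝓢(EuclideanSpace ℝ (Fin (n + 1)), ℂ)),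
      ‖cosD n t u (timeSlice t φ)‖
        ≤ C * s.sup (schwartzSeminormFamily ℂ (EuclideanSpace ℝ (Fin (n + 1))) ℂ) φ
          * (1 + t ^ 2)⁻¹ := by
  obtain ⟨s, C, hC, hw⟩ := exists_bound_functional (fourierFunctional u)
  obtain ⟨N₁, C₁, s₁, hC₁, h₁⟩ := (waveSymbol_polyBounded (n := n)).sup
    (fun _ => zero_le_one) (fun t => by simp) s
  obtain ⟨s₂, C₂, hC₂, h₂⟩ := exists_bound_clm
    (FourierTransform.fourierInvCLM ℂ 𝓢(EuclideanSpace ℝ (Fin n), ℂ)) s₁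
  obtain ⟨N₃, C₃, s₃, hC₃, h₃⟩ := (timeSlice_polyBounded (n := n) (N₁ + 2)).sup
    (fun _ => by positivity) (fun _ => le_rfl) s₂
  refine ⟨s₃, C * (C₁ * (C₂ * C₃)), by positivity, fun t φ => ?_⟩
  set S := s₃.sup (schwartzSeminormFamily ℂ (EuclideanSpace ℝ (Fin (n + 1))) ℂ) φ
  have hS : 0 ≤ S := apply_nonneg _ _
  have k₃ := h₃ t φ
  have k₂ := h₂ (timeSlice t φ)
  have k₁ := h₁ t (𝓕⁻ (timeSlice t φ))
  have k₀ := hw (SchwartzMap.smulLeftCLM ℂ (waveSymbol t) (𝓕⁻ (timeSlice t φ)))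
  rw [cosD_apply]
  have ht : (1 + |t|) ^ N₁ * ((1 + |t|) ^ (N₁ + 2))⁻¹ ≤ (1 + t ^ 2)⁻¹ := by
    have h1 : (0 : ℝ) < 1 + |t| := by positivity
    rw [pow_add, mul_inv, ← mul_assoc, mul_inv_cancel₀ (by positivity), one_mul]
    refine inv_anti₀ (by positivity) ?_
    rw [← sq_abs t]; nlinarith [abs_nonneg t]
  calc _ ≤ C * (1 * (C₁ * (1 + |t|) ^ N₁ * (C₂ * (((1 + |t|) ^ (N₁ + 2))⁻¹
          * (C₃ * 1 ^ N₃ * S))))) := by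
        refine k₀.trans (mul_le_mul_of_nonneg_left (k₁.trans ?_) hC)
        refine mul_le_mul_of_nonneg_left (mul_le_mul_of_nonneg_left ?_ (by positivity)) zero_le_one
        exact k₂.trans (mul_le_mul_of_nonneg_left k₃ hC₂)
    _ = C * (C₁ * (C₂ * C₃)) * S * ((1 + |t|) ^ N₁ * ((1 + |t|) ^ (N₁ + 2))⁻¹) := by
        rw [one_pow]; ring
    _ ≤ _ := mul_le_mul_of_nonneg_left ht (by positivity)

theorem integrable_cosD_timeSlice (u : 𝓢'(EuclideanSpace ℝ (Fin n), ℂ))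
    (φ : 𝓢(EuclideanSpace ℝ (Fin (n + 1)), ℂ)) :
    Integrable fun t => cosD n t u (timeSlice t φ) := by
  obtain ⟨s, C, -, h⟩ := exists_bound_cosD_timeSlice u
  exact (integrable_inv_one_add_sq.const_mul _).mono'
    (continuous_cosD_timeSlice u φ).aestronglyMeasurable (Filter.Eventually.of_forall fun t => h t φ)

/-- The tempered distribution `K u = Y₊(t) cos (t|D|) u` on `ℝⁿ⁺¹`, where `Y₊` is the characteristic
function of `[0, ∞)`: `⟨K u, φ⟩ = ∫_{t ≥ 0} ⟨cos (t|D|) u, φ (·, t)⟩ dt`. -/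
def waveDist (u : 𝓢'(EuclideanSpace ℝ (Fin n), ℂ)) : 𝓢'(EuclideanSpace ℝ (Fin (n + 1)), ℂ) :=
  ContinuousLinearMap.toPointwiseConvergenceCLM _ _ _ _ <|
    SchwartzMap.mkCLMtoNormedSpace (σ := RingHom.id ℂ)
      (fun φ => ∫ t in Set.Ici (0 : ℝ), cosD n t u (timeSlice t φ))
      (fun φ ψ => by
        simp only [map_add]
        exact integral_add (integrable_cosD_timeSlice u φ).integrableOn
          (integrable_cosD_timeSlice u ψ).integrableOn)
      (fun c φ => by
        simp only [map_smul]
        exact integral_smul c _)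
      (by
        obtain ⟨s, C, hC, h⟩ := exists_bound_cosD_timeSlice u
        have hI : 0 ≤ ∫ t in Set.Ici (0 : ℝ), (1 + t ^ 2)⁻¹ :=
          integral_nonneg fun t => by positivity
        refine ⟨s, C * ∫ t in Set.Ici (0 : ℝ), (1 + t ^ 2)⁻¹, by positivity, fun φ => ?_⟩
        refine (norm_integral_le_of_norm_le
          ((integrable_inv_one_add_sq.const_mul _).integrableOn)
          (Filter.Eventually.of_forall fun t => h t φ)).trans (le_of_eq ?_)
        rw [integral_const_mul]
        ring)

theorem waveDist_apply (u : 𝓢'(EuclideanSpace ℝ (Fin n), ℂ))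
    (φ : 𝓢(EuclideanSpace ℝ (Fin (n + 1)), ℂ)) :
    waveDist u φ = ∫ t in Set.Ici (0 : ℝ), cosD n t u (timeSlice t φ) := rfl

variable (n) in
/-- The linear operator `K : 𝓢'(ℝⁿ) → 𝓢'(ℝⁿ⁺¹)`, `(K u)(x, t) = Y₊(t) cos (t|D|) u(x)`. -/
def waveK : 𝓢'(EuclideanSpace ℝ (Fin n), ℂ) →ₗ[ℂ] 𝓢'(EuclideanSpace ℝ (Fin (n + 1)), ℂ) where
  toFun := waveDist
  map_add' u v := by
    ext φ
    have e : ∀ t, cosD n t (u + v) (timeSlice t φ)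
        = cosD n t u (timeSlice t φ) + cosD n t v (timeSlice t φ) := fun t => by
      rw [map_add]; rfl
    change waveDist (u + v) φ = waveDist u φ + waveDist v φ
    simp only [waveDist_apply, e]
    exact integral_add (integrable_cosD_timeSlice u φ).integrableOn
      (integrable_cosD_timeSlice v φ).integrableOn
  map_smul' c u := by
    ext φ
    have e : ∀ t, cosD n t (c • u) (timeSlice t φ) = c • cosD n t u (timeSlice t φ) := fun t => by
      rw [map_smul]; rfl
    change waveDist (c • u) φ = c • waveDist u φ
    simp only [waveDist_apply, e]
    exact integral_smul c _

theorem waveK_apply (u : 𝓢'(EuclideanSpace ℝ (Fin n), ℂ))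
    (φ : 𝓢(EuclideanSpace ℝ (Fin (n + 1)), ℂ)) :
    waveK n u φ = ∫ t in Set.Ici (0 : ℝ), cosD n t u (timeSlice t φ) := rfl

end spacetime

/-! ### The weighted Sobolev spaces -/

section sobolev

/-- The function `⟨x⟩ᵃ = (1 + |x|²)^(a/2)`. -/
def bracket (d : ℕ) (a : ℝ) (x : EuclideanSpace ℝ (Fin d)) : ℂ :=
  ((1 + ‖x‖ ^ 2) ^ (a / 2) : ℝ)

theorem hasTemperateGrowth_bracket (d : ℕ) (a : ℝ) :
    Function.HasTemperateGrowth (bracket d a) :=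
  Function.Complex.hasTemperateGrowth_ofReal.comp
    (Function.hasTemperateGrowth_one_add_norm_sq_rpow _ (a / 2))

theorem hasTemperateGrowth_bracket_two_pi (d : ℕ) (b : ℝ) :
    Function.HasTemperateGrowth fun ξ => bracket d b ((2 * Real.pi) • ξ) :=
  (hasTemperateGrowth_bracket d b).comp
    (f := fun ξ : EuclideanSpace ℝ (Fin d) => (2 * Real.pi) • ξ) (by fun_prop)

theorem bracket_mul_bracket_neg (d : ℕ) (a : ℝ) (x : EuclideanSpace ℝ (Fin d)) :
    bracket d a x * bracket d (-a) x = 1 := by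
  have h : (0 : ℝ) < 1 + ‖x‖ ^ 2 := by positivity
  rw [bracket, bracket, ← Complex.ofReal_mul, ← Real.rpow_add h, neg_div, add_neg_cancel,
    Real.rpow_zero, Complex.ofReal_one]

/-- The operator `⟨x⟩ᵃ ⟨D⟩ᵇ` on tempered distributions on `ℝᵈ`, where `D = -i∂` is multiplication
by `2πξ` on the Fourier transform side. -/
def weightOp (d : ℕ) (a b : ℝ) :
    𝓢'(EuclideanSpace ℝ (Fin d), ℂ) →L[ℂ] 𝓢'(EuclideanSpace ℝ (Fin d), ℂ) :=
  (TemperedDistribution.smulLeftCLM ℂ (bracket d a)).comp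
    (TemperedDistribution.fourierMultiplierCLM ℂ fun ξ => bracket d b ((2 * Real.pi) • ξ))

theorem weightOp_injective (d : ℕ) (a b : ℝ) : Function.Injective (weightOp d a b) := by
  have h1 : Function.LeftInverse (TemperedDistribution.smulLeftCLM ℂ (bracket d (-a)))
      (TemperedDistribution.smulLeftCLM ℂ (bracket d a)) := fun u => by
    rw [TemperedDistribution.smulLeftCLM_smulLeftCLM_apply (hasTemperateGrowth_bracket d _)
      (hasTemperateGrowth_bracket d _)]
    have : bracket d a * bracket d (-a) = fun _ => 1 :=
      funext fun x => bracket_mul_bracket_neg d a x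
    rw [this]; simp
  have h2 : Function.LeftInverse
      (TemperedDistribution.fourierMultiplierCLM ℂ fun ξ => bracket d (-b) ((2 * Real.pi) • ξ))
      (TemperedDistribution.fourierMultiplierCLM ℂ fun ξ => bracket d b ((2 * Real.pi) • ξ)) :=
    fun u => by
    rw [TemperedDistribution.fourierMultiplierCLM_fourierMultiplierCLM_apply
      (hasTemperateGrowth_bracket_two_pi d _) (hasTemperateGrowth_bracket_two_pi d _)]
    have : ((fun ξ => bracket d b ((2 * Real.pi) • ξ)) * fun ξ => bracket d (-b) ((2 * Real.pi) • ξ))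
        = fun _ => 1 := funext fun x => bracket_mul_bracket_neg d b _
    rw [this]; simp
  exact h1.injective.comp h2.injective

theorem toTemperedDistribution_injective (d : ℕ) : Function.Injective
    (Lp.toTemperedDistributionCLM ℂ (volume : Measure (EuclideanSpace ℝ (Fin d))) 2) :=
  LinearMap.ker_eq_bot.1 Lp.ker_toTemperedDistributionCLM_eq_bot

/-- The tempered distributions `u` on `ℝᵈ` with `⟨x⟩ᵃ ⟨D⟩ᵇ u ∈ L²`. -/
def weightedSobolevSubmodule (d : ℕ) (a b : ℝ) :
    Submodule ℂ 𝓢'(EuclideanSpace ℝ (Fin d), ℂ) :=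
  (LinearMap.range (Lp.toTemperedDistributionCLM ℂ
    (volume : Measure (EuclideanSpace ℝ (Fin d))) 2).toLinearMap).comap (weightOp d a b).toLinearMap

/-- The space `H_{(a,b)}(ℝᵈ)` of all tempered distributions `u` on `ℝᵈ` with `⟨x⟩ᵃ ⟨D⟩ᵇ u ∈ L²`,
with the norm `‖⟨x⟩ᵃ ⟨D⟩ᵇ u‖_{L²}`. -/
def WeightedSobolev (d : ℕ) (a b : ℝ) : Type := weightedSobolevSubmodule d a b

namespace WeightedSobolev

variable {d : ℕ} {a b : ℝ}

instance : AddCommGroup (WeightedSobolev d a b) :=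
  inferInstanceAs (AddCommGroup (weightedSobolevSubmodule d a b))

instance : Module ℂ (WeightedSobolev d a b) :=
  inferInstanceAs (Module ℂ (weightedSobolevSubmodule d a b))

/-- The inclusion of `H_{(a,b)}(ℝᵈ)` in the tempered distributions. -/
def toDist : WeightedSobolev d a b →ₗ[ℂ] 𝓢'(EuclideanSpace ℝ (Fin d), ℂ) :=
  (weightedSobolevSubmodule d a b).subtype

theorem toDist_injective : Function.Injective (toDist (d := d) (a := a) (b := b)) :=
  Subtype.val_injective

/-- The map `u ↦ ⟨x⟩ᵃ ⟨D⟩ᵇ u` from `H_{(a,b)}(ℝᵈ)` to `L²(ℝᵈ)`. -/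
def toL2 : WeightedSobolev d a b →ₗ[ℂ] Lp ℂ 2 (volume : Measure (EuclideanSpace ℝ (Fin d))) :=
  (LinearEquiv.ofInjective _ (toTemperedDistribution_injective d)).symm.toLinearMap.comp
    (((weightOp d a b).toLinearMap.comp toDist).codRestrict _ fun u => u.2)

theorem coe_toL2 (u : WeightedSobolev d a b) :
    Lp.toTemperedDistribution (toL2 u) = weightOp d a b (toDist u) :=
  congrArg Subtype.val ((LinearEquiv.ofInjective _
    (toTemperedDistribution_injective d)).apply_symm_apply
      ⟨weightOp d a b (toDist u), u.2⟩)

theorem toL2_injective : Function.Injective (toL2 (d := d) (a := a) (b := b)) := fun u v h =>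
  toDist_injective (weightOp_injective d a b (by rw [← coe_toL2, ← coe_toL2, h]))

instance : NormedAddCommGroup (WeightedSobolev d a b) :=
  NormedAddCommGroup.induced _ _ toL2 toL2_injective

theorem norm_eq (u : WeightedSobolev d a b) : ‖u‖ = ‖toL2 u‖ := rfl

instance : NormedSpace ℂ (WeightedSobolev d a b) where
  norm_smul_le c u := by rw [norm_eq, norm_eq, map_smul, norm_smul]

end WeightedSobolev

end sobolev

end

end WaveK

/-!
By duality, `K` is bounded if the pairing of `⟨X⟩^(a - 1/2) ⟨D⟩ᵇ K u`, `X = (x, t)`, with every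
Schwartz function `φ` is at most `C ‖u‖ ‖φ‖` (`exists_norm_weightOp_waveK_le`); the Riesz
representation theorem and the density of Schwartz functions in `L²` do the rest
(`exists_toTemperedDistribution_eq`). Write `v = ⟨x⟩ᵃ ⟨D⟩ᵇ u ∈ L²` and `γ = 1/2 - a > 0`. Moving all
operators to the side of `φ`, the pairing becomes
`∫_{t ≥ 0} ∫ ⟨x⟩⁻ᵃ v (x) (cos (t|D|) χ (·, t)) (x) dx dt` with
`χ = ⟨D_x⟩⁻ᵇ ⟨D⟩ᵇ ⟨X⟩^(-γ) φ`. Here `⟨D_x⟩⁻ᵇ` acts on each time slice (`timeSlice_dualMult`).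

Everything rests on one estimate (`IsSymbolSpace.weightBound`): if all derivatives of the symbol `g`
are bounded, then the multipliers with the symbols `g (r ξ)`, `|r| ≤ 2πρ`, are bounded on `L²` with
the weight `(ρ² + |x|²)^γ`, uniformly in `r` and `ρ`. For `γ = 0` this is Plancherel's theorem; the
step from `γ` to `γ + 1` commutes the multiplier with the coordinates, which differentiates the
symbol; and the exponents between `0` and `1` follow by real interpolation.

The estimate is used twice.
* The symbol `⟨ξ⟩⁻ᵇ ⟨(ξ, τ)⟩ᵇ` has bounded derivatives when `b ≤ 0`, so the norm of `χ` in `L²` with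
  the weight `⟨X⟩^(2γ)` is at most `C ‖φ‖` (`exists_wsq_bracket_le`).
* The symbol `cos |ξ|` has bounded derivatives (`isSymbolSpace_cosGen`), so `cos (t|D|)` is bounded
  on `L²` with the weight `(1 + t² + |x|²)^γ`, uniformly in `t`. This replaces finite speed of
  propagation (`exists_wsq_dualMult_waveSymbol_le`).

At the time `t` the weight `(1 + t² + |x|²)^γ` is the restriction of `⟨X⟩^(2γ)`. By the
Cauchy–Schwarz inequality in `x` and in `t` the pairing is therefore bounded by `‖φ‖` times the square
root of `∫ |v|² ⟨x⟩^(-2a) ∫_{t ≥ 0} (1 + t² + |x|²)^(-γ) dt dx`. As `2γ = 1 - 2a > 1`, the integral in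
`t` converges, and it is a constant times `⟨x⟩^(2a)`, which cancels the weight
(`lintegral_pairing_le`).
-/

namespace WaveK
noncomputable section

set_option linter.unusedSectionVars false

/-! ### Algebras of bounded symbols stable under differentiation -/

section symbols

variable {E : Type*} [NormedAddCommGroup E] [NormedSpace ℝ E]

/-- A set of symbols which are bounded, smooth of temperate growth, and whose directional
derivatives are again in the set. All derivatives of such a symbol are bounded. -/
structure IsSymbolSpace (S : Set (E → ℂ)) : Prop where
  hasTemperateGrowth : ∀ g ∈ S, Function.HasTemperateGrowth g
  bounded : ∀ g ∈ S, ∃ C : ℝ, ∀ x, ‖g x‖ ≤ C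
  fderiv_mem : ∀ g ∈ S, ∀ e, (fun x => fderiv ℝ g x e) ∈ S

theorem differentiable_of_hasTemperateGrowth {g : E → ℂ} (hg : g.HasTemperateGrowth) :
    Differentiable ℝ g :=
  hg.1.differentiable (by simp)

/-- By the product rule it suffices to differentiate the generators of an algebra of symbols. -/
theorem isSymbolSpace_adjoin {G : Set (E → ℂ)} (h1 : ∀ g ∈ G, Function.HasTemperateGrowth g)
    (h2 : ∀ g ∈ G, ∃ C : ℝ, ∀ x, ‖g x‖ ≤ C)
    (h3 : ∀ g ∈ G, ∀ e, (fun x => fderiv ℝ g x e) ∈ Algebra.adjoin ℂ G) :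
    IsSymbolSpace (Algebra.adjoin ℂ G : Set (E → ℂ)) := by
  have ht : ∀ g ∈ Algebra.adjoin ℂ G, Function.HasTemperateGrowth g := by
    intro g hg
    induction hg using Algebra.adjoin_induction with
    | mem g hg => exact h1 g hg
    | algebraMap c => exact Function.HasTemperateGrowth.const c
    | add f g _ _ hf hg => exact hf.add hg
    | mul f g _ _ hf hg => exact hf.mul hg
  refine ⟨ht, ?_, ?_⟩
  · intro g hg
    induction hg using Algebra.adjoin_induction with
    | mem g hg => exact h2 g hg
    | algebraMap c => exact ⟨‖c‖, fun _ => le_rfl⟩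
    | add f g _ _ hf hg =>
      obtain ⟨A, hA⟩ := hf
      obtain ⟨B, hB⟩ := hg
      exact ⟨A + B, fun x => (norm_add_le _ _).trans (add_le_add (hA x) (hB x))⟩
    | mul f g _ _ hf hg =>
      obtain ⟨A, hA⟩ := hf
      obtain ⟨B, hB⟩ := hg
      refine ⟨A * B, fun x => ?_⟩
      rw [Pi.mul_apply, norm_mul]
      exact mul_le_mul (hA x) (hB x) (norm_nonneg _) ((norm_nonneg _).trans (hA x))
  · intro g hg e
    rw [SetLike.mem_coe]
    induction hg using Algebra.adjoin_induction with
    | mem g hg => exact h3 g hg e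
    | algebraMap c =>
      have : (fun x => fderiv ℝ (algebraMap ℂ (E → ℂ) c) x e) = 0 := by
        ext x
        change fderiv ℝ (fun _ => c) x e = 0
        simp
      rw [this]
      exact Subalgebra.zero_mem _
    | add f g hf hg hf' hg' =>
      have : (fun x => fderiv ℝ (f + g) x e)
          = (fun x => fderiv ℝ f x e) + fun x => fderiv ℝ g x e := by
        ext x
        rw [fderiv_add (differentiable_of_hasTemperateGrowth (ht f hf) x)
          (differentiable_of_hasTemperateGrowth (ht g hg) x)]
        rfl
      rw [this]
      exact Subalgebra.add_mem _ hf' hg'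
    | mul f g hf hg hf' hg' =>
      have : (fun x => fderiv ℝ (f * g) x e)
          = f * (fun x => fderiv ℝ g x e) + g * fun x => fderiv ℝ f x e := by
        ext x
        rw [fderiv_mul (differentiable_of_hasTemperateGrowth (ht f hf) x)
          (differentiable_of_hasTemperateGrowth (ht g hg) x)]
        rfl
      rw [this]
      exact Subalgebra.add_mem _ (Subalgebra.mul_mem _ hf hg') (Subalgebra.mul_mem _ hg hf')

theorem hasTemperateGrowth_comp_smul {g : E → ℂ} (hg : g.HasTemperateGrowth) (r : ℝ) :
    Function.HasTemperateGrowth fun x => g (r • x) :=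
  hg.comp (f := fun x : E => r • x) (by fun_prop)

end symbols

/-! ### Fourier multipliers on Schwartz functions -/

section multiplier

variable {E : Type*} [NormedAddCommGroup E] [InnerProductSpace ℝ E] [FiniteDimensional ℝ E]
  [MeasurableSpace E] [BorelSpace E]

/-- The operator `φ ↦ 𝓕 (σ 𝓕⁻¹ φ)` on Schwartz functions: the transpose of the Fourier multiplier
with symbol `σ` on tempered distributions. -/
def dualMult (σ : E → ℂ) : 𝓢(E, ℂ) →L[ℂ] 𝓢(E, ℂ) :=
  (FourierTransform.fourierCLM ℂ 𝓢(E, ℂ)) ∘L (SchwartzMap.smulLeftCLM ℂ σ) ∘L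
    (FourierTransform.fourierInvCLM ℂ 𝓢(E, ℂ))

theorem dualMult_apply (σ : E → ℂ) (f : 𝓢(E, ℂ)) :
    dualMult σ f = 𝓕 (SchwartzMap.smulLeftCLM ℂ σ (𝓕⁻ f)) := rfl

theorem dualMult_dualMult {σ τ : E → ℂ} (hσ : σ.HasTemperateGrowth) (hτ : τ.HasTemperateGrowth)
    (f : 𝓢(E, ℂ)) : dualMult σ (dualMult τ f) = dualMult (σ * τ) f := by
  rw [dualMult_apply, dualMult_apply, FourierTransform.fourierInv_fourier_eq,
    SchwartzMap.smulLeftCLM_smulLeftCLM_apply hσ hτ]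
  rfl

open LineDeriv in
/-- Multiplication by a coordinate commutes with a multiplier up to the multiplier whose symbol is
the derivative. -/
theorem inner_mul_dualMult {σ : E → ℂ} (hσ : σ.HasTemperateGrowth) (e : E)
    (hσe : Function.HasTemperateGrowth fun x => fderiv ℝ σ x e) (f : 𝓢(E, ℂ)) :
    (2 * Real.pi * Complex.I) • SchwartzMap.smulLeftCLM ℂ (inner ℝ · e) (dualMult σ f)
      = (2 * Real.pi * Complex.I) • dualMult σ (SchwartzMap.smulLeftCLM ℂ (inner ℝ · e) f)
        + dualMult (fun x => fderiv ℝ σ x e) f := by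
  rw [dualMult_apply, ← SchwartzMap.fourier_lineDerivOp_eq, ← map_smul]
  have h2 : dualMult σ ((2 * Real.pi * Complex.I) • SchwartzMap.smulLeftCLM ℂ (inner ℝ · e) f)
      = 𝓕 (SchwartzMap.smulLeftCLM ℂ σ (∂_{e} (𝓕⁻ f))) := by
    rw [SchwartzMap.lineDerivOp_fourierInv_eq, dualMult_apply]
  rw [h2, dualMult_apply, ← FourierTransform.fourier_add]
  congr 1
  ext x
  rw [SchwartzMap.lineDerivOp_apply_eq_fderiv, SchwartzMap.smulLeftCLM_apply hσ, add_apply,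
    SchwartzMap.smulLeftCLM_apply_apply hσ, SchwartzMap.smulLeftCLM_apply_apply hσe,
    SchwartzMap.lineDerivOp_apply_eq_fderiv]
  generalize 𝓕⁻ f = h
  have := fderiv_mul (differentiable_of_hasTemperateGrowth hσ x) (h.differentiableAt (x := x))
  change fderiv ℝ (σ * ⇑h) x e = _
  rw [this]
  simp [mul_comm]

/-- The integral `∫ w |f|²`. -/
def wsq (w : E → ℝ) (f : E → ℂ) : ENNReal := ∫⁻ x, ENNReal.ofReal (w x * ‖f x‖ ^ 2)

theorem lintegral_norm_sq_fourier (f : 𝓢(E, ℂ)) :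
    ∫⁻ x, ENNReal.ofReal (‖𝓕 f x‖ ^ 2) = ∫⁻ x, ENNReal.ofReal (‖f x‖ ^ 2) := by
  have h : ∀ g : 𝓢(E, ℂ), Integrable fun x => ‖g x‖ ^ 2 := fun g =>
    (memLp_two_iff_integrable_sq_norm g.continuous.aestronglyMeasurable).1 (g.memLp 2)
  rw [← ofReal_integral_eq_lintegral_ofReal (h _) (ae_of_all _ fun x => by positivity),
    ← ofReal_integral_eq_lintegral_ofReal (h _) (ae_of_all _ fun x => by positivity),
    SchwartzMap.integral_norm_sq_fourier]

theorem lintegral_norm_sq_dualMult_le {σ : E → ℂ} (hσ : σ.HasTemperateGrowth) {C : ℝ}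
    (hC : ∀ x, ‖σ x‖ ≤ C) (f : 𝓢(E, ℂ)) :
    ∫⁻ x, ENNReal.ofReal (‖dualMult σ f x‖ ^ 2)
      ≤ ENNReal.ofReal (C ^ 2) * ∫⁻ x, ENNReal.ofReal (‖f x‖ ^ 2) := by
  have h0 : ∫⁻ x, ENNReal.ofReal (‖f x‖ ^ 2) = ∫⁻ x, ENNReal.ofReal (‖(𝓕⁻ f) x‖ ^ 2) := by
    rw [← lintegral_norm_sq_fourier (𝓕⁻ f), FourierTransform.fourier_fourierInv_eq]
  rw [dualMult_apply, lintegral_norm_sq_fourier, h0, ← lintegral_const_mul' _ _ (by simp)]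
  refine lintegral_mono fun x => ?_
  rw [← ENNReal.ofReal_mul (by positivity), SchwartzMap.smulLeftCLM_apply_apply hσ, norm_smul,
    mul_pow]
  have := hC x
  gcongr

end multiplier

/-! ### Weighted square integrals -/

section weights

variable {E : Type*} [NormedAddCommGroup E] [InnerProductSpace ℝ E] [FiniteDimensional ℝ E]
  [MeasurableSpace E] [BorelSpace E]

theorem wsq_const_mul (c : NNReal) (w : E → ℝ) (f : E → ℂ) :
    wsq (fun x => c * w x) f = c * wsq w f := by
  rw [wsq, wsq, ← lintegral_const_mul' _ _ ENNReal.coe_ne_top]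
  refine lintegral_congr fun x => ?_
  rw [mul_assoc, ENNReal.ofReal_mul c.coe_nonneg, ENNReal.ofReal_coe_nnreal]

theorem measurable_wsq_integrand {w : E → ℝ} (hw : Measurable w) (f : 𝓢(E, ℂ)) :
    Measurable fun x => ENNReal.ofReal (w x * ‖f x‖ ^ 2) := by
  have := f.continuous.measurable
  fun_prop

theorem wsq_le_add {w w₁ w₂ : E → ℝ} {f f₂ : E → ℂ} {f₁ : 𝓢(E, ℂ)} (hw₁ : Measurable w₁)
    (h₁ : ∀ x, 0 ≤ w₁ x) (h₂ : ∀ x, 0 ≤ w₂ x)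
    (h : ∀ x, w x * ‖f x‖ ^ 2 ≤ w₁ x * ‖f₁ x‖ ^ 2 + w₂ x * ‖f₂ x‖ ^ 2) :
    wsq w f ≤ wsq w₁ f₁ + wsq w₂ f₂ := by
  rw [wsq, wsq, wsq, ← lintegral_add_left (measurable_wsq_integrand hw₁ f₁)]
  refine lintegral_mono fun x => ?_
  rw [← ENNReal.ofReal_add (mul_nonneg (h₁ x) (by positivity)) (mul_nonneg (h₂ x) (by positivity))]
  exact ENNReal.ofReal_le_ofReal (h x)

theorem add_le_wsq {w w₁ w₂ : E → ℝ} {f f₂ : E → ℂ} {f₁ : 𝓢(E, ℂ)} (hw₁ : Measurable w₁)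
    (h₁ : ∀ x, 0 ≤ w₁ x) (h₂ : ∀ x, 0 ≤ w₂ x)
    (h : ∀ x, w₁ x * ‖f₁ x‖ ^ 2 + w₂ x * ‖f₂ x‖ ^ 2 ≤ w x * ‖f x‖ ^ 2) :
    wsq w₁ f₁ + wsq w₂ f₂ ≤ wsq w f := by
  rw [wsq, wsq, wsq, ← lintegral_add_left (measurable_wsq_integrand hw₁ f₁)]
  refine lintegral_mono fun x => ?_
  rw [← ENNReal.ofReal_add (mul_nonneg (h₁ x) (by positivity)) (mul_nonneg (h₂ x) (by positivity))]
  exact ENNReal.ofReal_le_ofReal (h x)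

theorem norm_add_sq_le_two_mul (z w : ℂ) : ‖z + w‖ ^ 2 ≤ 2 * ‖z‖ ^ 2 + 2 * ‖w‖ ^ 2 := by
  nlinarith [norm_add_le z w, norm_nonneg z, norm_nonneg w, norm_nonneg (z + w),
    sq_nonneg (‖z‖ - ‖w‖)]

/-- The weight `(ρ² + |x|²)^γ`. -/
def wt (ρ γ : ℝ) (x : E) : ℝ := (ρ ^ 2 + ‖x‖ ^ 2) ^ γ

theorem wt_nonneg (ρ γ : ℝ) (x : E) : 0 ≤ wt ρ γ x := by unfold wt; positivity

theorem measurable_wt (ρ γ : ℝ) : Measurable (wt ρ γ : E → ℝ) := by unfold wt; fun_prop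

theorem wt_add_one {ρ : ℝ} (hρ : 0 < ρ) (γ : ℝ) (x : E) :
    wt ρ (γ + 1) x = wt ρ γ x * (ρ ^ 2 + ‖x‖ ^ 2) := by
  rw [wt, Real.rpow_add_one (by positivity)]; rfl

/-- The weighted norm of order `γ + 1` of `f` is made up of those of order `γ` of `f` and all `x_i f`. -/
theorem wsq_wt_add_one {ρ : ℝ} (hρ : 0 < ρ) (γ : ℝ) (f : 𝓢(E, ℂ)) :
    wsq (wt ρ (γ + 1)) f = ENNReal.ofReal (ρ ^ 2) * wsq (wt ρ γ) f
      + ∑ i, wsq (wt ρ γ)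
        (SchwartzMap.smulLeftCLM ℂ (inner ℝ · (stdOrthonormalBasis ℝ E i)) f) := by
  have ht : ∀ e : E, Function.HasTemperateGrowth fun x : E => inner ℝ x e := fun e => by fun_prop
  simp only [wsq]
  rw [← lintegral_const_mul' _ _ (by simp), ← lintegral_finsetSum _ fun i _ =>
    measurable_wsq_integrand (measurable_wt ρ γ) _, ← lintegral_add_left
    ((measurable_wsq_integrand (measurable_wt ρ γ) f).const_mul _)]
  refine lintegral_congr fun x => ?_
  have h0 := wt_nonneg ρ γ x
  rw [← ENNReal.ofReal_mul (by positivity), ← ENNReal.ofReal_sum_of_nonneg fun i _ => by positivity,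
    ← ENNReal.ofReal_add (by positivity) (Finset.sum_nonneg fun i _ => by positivity),
    wt_add_one hρ, ← (stdOrthonormalBasis ℝ E).sum_sq_inner_left x, mul_add, add_mul, Finset.mul_sum,
    Finset.sum_mul]
  congr 1
  congr 1
  · ring
  · refine Finset.sum_congr rfl fun i _ => ?_
    rw [SchwartzMap.smulLeftCLM_apply_apply (ht _), norm_smul, mul_pow, Real.norm_eq_abs, sq_abs]
    ring

theorem lintegral_rpow_min {θ : ℝ} (h0 : 0 < θ) (h1 : θ < 1) {w : ℝ} (hw : 0 < w) :
    ∫⁻ l in Set.Ioi (0 : ℝ), ENNReal.ofReal (l ^ (θ - 2) * min l w)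
      = ENNReal.ofReal ((1 / θ + 1 / (1 - θ)) * w ^ θ) := by
  rw [← Set.Ioc_union_Ioi_eq_Ioi hw.le, lintegral_union measurableSet_Ioi
    (Set.Ioc_disjoint_Ioi le_rfl)]
  have e1 : ∫⁻ l in Set.Ioc 0 w, ENNReal.ofReal (l ^ (θ - 2) * min l w)
      = ENNReal.ofReal (w ^ θ / θ) := by
    have hi : IntegrableOn (fun l : ℝ => l ^ (θ - 1)) (Set.Ioc 0 w) :=
      (intervalIntegrable_iff_integrableOn_Ioc_of_le hw.le).1
        (intervalIntegral.intervalIntegrable_rpow' (by linarith))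
    have hv := integral_rpow (a := 0) (b := w) (r := θ - 1) (Or.inl (by linarith))
    rw [sub_add_cancel, Real.zero_rpow h0.ne', sub_zero, intervalIntegral.integral_of_le hw.le] at hv
    rw [← hv, ofReal_integral_eq_lintegral_ofReal hi ((ae_restrict_iff' measurableSet_Ioc).2
      (ae_of_all _ fun l hl => Real.rpow_nonneg hl.1.le _))]
    refine setLIntegral_congr_fun measurableSet_Ioc fun l hl => ?_
    rw [min_eq_left hl.2, ← Real.rpow_add_one hl.1.ne']
    congr 2; ring
  have e2 : ∫⁻ l in Set.Ioi w, ENNReal.ofReal (l ^ (θ - 2) * min l w)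
      = ENNReal.ofReal (w ^ θ / (1 - θ)) := by
    have hi := integrableOn_Ioi_rpow_of_lt (a := θ - 2) (by linarith) hw
    have hv := integral_Ioi_rpow_of_lt (a := θ - 2) (by linarith) hw
    have hv' : ∫ l in Set.Ioi w, l ^ (θ - 2) * w = w ^ θ / (1 - θ) := by
      rw [integral_mul_const, hv, show θ - 2 + 1 = θ - 1 by ring, Real.rpow_sub_one hw.ne']
      have : θ - 1 ≠ 0 := by linarith
      have : 1 - θ ≠ 0 := by linarith
      field_simp
      ring
    rw [← hv', ofReal_integral_eq_lintegral_ofReal (hi.mul_const w)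
      ((ae_restrict_iff' measurableSet_Ioi).2 (ae_of_all _ fun l hl =>
        mul_nonneg (Real.rpow_nonneg (hw.trans hl).le _) hw.le))]
    refine setLIntegral_congr_fun measurableSet_Ioi fun l hl => ?_
    rw [min_eq_right (le_of_lt hl)]
  have := Real.rpow_pos_of_pos hw θ
  have h1' : 0 < 1 - θ := by linarith
  rw [e1, e2, ← ENNReal.ofReal_add (by positivity) (by positivity)]
  congr 1; ring

/-- The weight `w ^ θ` is, up to a constant, a superposition of the weights `min l w`. As these come
from the `K`-functional of the weights `1` and `w`, this is real interpolation. -/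
theorem lintegral_wsq_min {θ : ℝ} (h0 : 0 < θ) (h1 : θ < 1) {w : E → ℝ} (hm : Measurable w)
    (hw : ∀ x, 0 < w x) (f : 𝓢(E, ℂ)) :
    ∫⁻ l in Set.Ioi (0 : ℝ), ENNReal.ofReal (l ^ (θ - 2)) * wsq (fun x => min l (w x)) f
      = ENNReal.ofReal (1 / θ + 1 / (1 - θ)) * wsq (fun x => w x ^ θ) f := by
  have hf := f.continuous.measurable
  have h1' : 0 < 1 - θ := by linarith
  simp only [wsq]
  rw [← lintegral_const_mul' _ _ (by simp)]
  simp_rw [← lintegral_const_mul' _ _ ENNReal.ofReal_ne_top]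
  rw [lintegral_lintegral_swap (by fun_prop)]
  refine lintegral_congr fun x => ?_
  have e : ∀ l ∈ Set.Ioi (0 : ℝ),
      ENNReal.ofReal (l ^ (θ - 2)) * ENNReal.ofReal (min l (w x) * ‖f x‖ ^ 2)
      = ENNReal.ofReal (l ^ (θ - 2) * min l (w x)) * ENNReal.ofReal (‖f x‖ ^ 2) := fun l hl => by
    have hl' := Real.rpow_nonneg (le_of_lt hl : (0 : ℝ) ≤ l) (θ - 2)
    have := le_min (le_of_lt hl) (hw x).le
    rw [← ENNReal.ofReal_mul hl', ← ENNReal.ofReal_mul (by positivity), mul_assoc]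
  have := Real.rpow_pos_of_pos (hw x) θ
  rw [setLIntegral_congr_fun measurableSet_Ioi e, lintegral_mul_const' _ _ ENNReal.ofReal_ne_top,
    lintegral_rpow_min h0 h1 (hw x), ← ENNReal.ofReal_mul (by positivity),
    ← ENNReal.ofReal_mul (by positivity), mul_assoc]

end weights

/-! ### Weighted estimates for multipliers -/

section weighted

variable {E : Type*} [NormedAddCommGroup E] [InnerProductSpace ℝ E] [FiniteDimensional ℝ E]
  [MeasurableSpace E] [BorelSpace E]

/-- The multipliers with the symbols `g (r ξ)`, `|r| ≤ 2πρ`, `g ∈ S`, are bounded on `L²` with the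
weight `(ρ² + |x|²)^γ`, uniformly in `r` and `ρ`. -/
def WeightBound (S : Set (E → ℂ)) (γ : ℝ) : Prop :=
  ∀ g ∈ S, ∃ C : NNReal, ∀ r ρ : ℝ, 0 < ρ → |r| ≤ 2 * Real.pi * ρ → ∀ f : 𝓢(E, ℂ),
    wsq (wt ρ γ) (dualMult (fun x => g (r • x)) f) ≤ C * wsq (wt ρ γ) f

theorem IsSymbolSpace.weightBound_zero {S : Set (E → ℂ)} (hS : IsSymbolSpace S) :
    WeightBound S 0 := fun g hg => by
  obtain ⟨C, hC⟩ := hS.bounded g hg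
  refine ⟨(C ^ 2).toNNReal, fun r ρ _ _ f => ?_⟩
  have := lintegral_norm_sq_dualMult_le
    (hasTemperateGrowth_comp_smul (hS.hasTemperateGrowth g hg) r) (fun x => hC _) f
  simpa [wsq, wt, ENNReal.ofReal] using this

/-- Passing from `γ` to `γ + 1` means to commute the multiplier with the coordinates. The commutator
brings a factor `r / 2π`, which is at most `ρ`. -/
theorem IsSymbolSpace.weightBound_add_one {S : Set (E → ℂ)} (hS : IsSymbolSpace S) {γ : ℝ}
    (h : WeightBound S γ) : WeightBound S (γ + 1) := fun g hg => by
  obtain ⟨C, hC⟩ := h g hg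
  set b := stdOrthonormalBasis ℝ E
  choose D hD using fun i => h _ (hS.fderiv_mem g hg (b i))
  have hgt := hS.hasTemperateGrowth g hg
  refine ⟨2 * C + ∑ i, 2 * D i, fun r ρ hρ hr f => ?_⟩
  set F := dualMult (fun x => g (r • x)) f with hF
  set X : Fin (Module.finrank ℝ E) → 𝓢(E, ℂ) → 𝓢(E, ℂ) := fun i =>
    SchwartzMap.smulLeftCLM ℂ (inner ℝ · (b i)) with hX
  set A := wsq (wt ρ γ) f with hA
  have key : ∀ i, wsq (wt ρ γ) (X i F)
      ≤ 2 * C * wsq (wt ρ γ) (X i f) + ENNReal.ofReal (ρ ^ 2) * (2 * D i * A) := fun i => by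
    set G := dualMult (fun x => g (r • x)) (X i f) with hG
    set H := dualMult (fun x => fderiv ℝ g (r • x) (b i)) f with hH
    have hGC := hC r ρ hρ hr (X i f)
    have hHD := hD i r ρ hρ hr f
    have hd : (fun x => fderiv ℝ (fun y => g (r • y)) x (b i))
        = fun x => r • fderiv ℝ g (r • x) (b i) := by
      ext x
      have := ((differentiable_of_hasTemperateGrowth hgt (r • x)).hasFDerivAt.comp x
        ((hasFDerivAt_id x).const_smul r)).fderiv
      change fderiv ℝ (g ∘ fun y => r • y) x (b i) = _
      rw [this]
      simp
    have htd := hasTemperateGrowth_comp_smul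
      (hS.hasTemperateGrowth _ (hS.fderiv_mem g hg (b i))) r
    have hsm : dualMult (fun x => r • fderiv ℝ g (r • x) (b i)) f = (r : ℂ) • H := by
      have : (fun x => r • fderiv ℝ g (r • x) (b i))
          = (r : ℂ) • fun x => fderiv ℝ g (r • x) (b i) := by ext x; simp
      rw [this, dualMult_apply, SchwartzMap.smulLeftCLM_smul htd, hH, dualMult_apply,
        ← FourierTransform.fourier_smul]
      rfl
    have hcomm := inner_mul_dualMult (hasTemperateGrowth_comp_smul hgt r) (b i) (by
      rw [hd]; exact (Function.HasTemperateGrowth.const r).smul htd) f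
    rw [hd, hsm] at hcomm
    have hpt : ∀ x, ‖X i F x‖ ^ 2 ≤ 2 * ‖G x‖ ^ 2 + 2 * (ρ ^ 2 * ‖H x‖ ^ 2) := fun x => by
      have hx := congrArg (fun φ : 𝓢(E, ℂ) => φ x) hcomm
      simp only [add_apply, smul_apply, smul_eq_mul] at hx
      have hpi : (2 * Real.pi * Complex.I : ℂ) ≠ 0 := by simp [Real.pi_ne_zero]
      have e : X i F x = G x + (r / (2 * Real.pi * Complex.I)) * H x := by
        apply mul_left_cancel₀ hpi
        refine hx.trans ?_
        field_simp
        rfl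
      rw [e]
      refine (norm_add_sq_le_two_mul _ _).trans ?_
      have hn : ‖(r / (2 * Real.pi * Complex.I) : ℂ)‖ ≤ ρ := by
        rw [norm_div, norm_mul, norm_mul, Complex.norm_I, Complex.norm_real, Complex.norm_real,
          Real.norm_eq_abs, Real.norm_of_nonneg Real.pi_pos.le, mul_one, RCLike.norm_ofNat,
          div_le_iff₀ (by positivity), mul_comm]
        exact hr
      rw [norm_mul, mul_pow]
      gcongr
    have hw := fun x : E => wt_nonneg ρ γ x
    calc wsq (wt ρ γ) (X i F) ≤ wsq (fun x => (2 : NNReal) * wt ρ γ x) G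
          + wsq (fun x => (2 * (ρ ^ 2).toNNReal : NNReal) * wt ρ γ x) H := by
          refine wsq_le_add (by have := measurable_wt (E := E) ρ γ; fun_prop)
            (fun x => mul_nonneg (by positivity) (hw x)) (fun x => mul_nonneg (by positivity) (hw x))
            fun x => ?_
          have := mul_le_mul_of_nonneg_left (hpt x) (hw x)
          push_cast
          rw [Real.coe_toNNReal _ (by positivity)]
          linarith
      _ = 2 * wsq (wt ρ γ) G + 2 * ENNReal.ofReal (ρ ^ 2) * wsq (wt ρ γ) H := by
          rw [wsq_const_mul, wsq_const_mul]; push_cast; rfl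
      _ ≤ 2 * (C * wsq (wt ρ γ) (X i f)) + 2 * ENNReal.ofReal (ρ ^ 2) * (D i * A) := by gcongr
      _ = _ := by ring
  rw [wsq_wt_add_one hρ, wsq_wt_add_one hρ]
  calc _ ≤ ENNReal.ofReal (ρ ^ 2) * (C * A)
        + ∑ i, (2 * C * wsq (wt ρ γ) (X i f) + ENNReal.ofReal (ρ ^ 2) * (2 * D i * A)) :=
        add_le_add (mul_le_mul_right (hC r ρ hρ hr f) _) (Finset.sum_le_sum fun i _ => key i)
    _ = (C + (∑ i, 2 * D i : NNReal)) * (ENNReal.ofReal (ρ ^ 2) * A)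
        + 2 * C * ∑ i, wsq (wt ρ γ) (X i f) := by
        rw [Finset.sum_add_distrib, ← Finset.mul_sum, ← Finset.mul_sum, ← Finset.sum_mul]; push_cast; ring
    _ ≤ (2 * C + (∑ i, 2 * D i : NNReal)) * (ENNReal.ofReal (ρ ^ 2) * A)
        + (2 * C + (∑ i, 2 * D i : NNReal)) * ∑ i, wsq (wt ρ γ) (X i f) := by
        gcongr
        · rw [two_mul]; exact le_self_add
        · exact le_self_add
    _ = _ := by push_cast; rw [mul_add]

theorem hasTemperateGrowth_inv_add_norm_sq {c : ℝ} (hc : 0 < c) :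
    Function.HasTemperateGrowth fun x : E => (c + ‖x‖ ^ 2)⁻¹ := by
  have h1 := (Function.hasTemperateGrowth_one_add_norm_sq_rpow E (-1)).comp
    (f := fun x : E => (√c)⁻¹ • x) (by fun_prop)
  have h2 := (Function.HasTemperateGrowth.const (E := E) c⁻¹).mul h1
  convert! h2 using 1
  ext x
  simp only [Pi.mul_apply, Function.comp_apply, norm_smul, mul_pow, norm_inv, Real.norm_eq_abs,
    inv_pow, sq_abs, Real.sq_sqrt hc.le]
  rw [Real.rpow_neg_one, ← mul_inv]
  congr 1
  field_simp

/-- The weights `1` and `ρ² + |x|²` control every `min l (ρ² + |x|²)`, with a constant that does not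
depend on `l`: one splits `f` smoothly where the weight `ρ² + |x|²` crosses the level `l`. -/
theorem wsq_min_dualMult_le {σ : E → ℂ} {C₀ C₁ : NNReal} {ρ : ℝ} (hρ : 0 < ρ)
    (h₀ : ∀ f, wsq (wt ρ 0) (dualMult σ f) ≤ C₀ * wsq (wt ρ 0) f)
    (h₁ : ∀ f, wsq (wt ρ 1) (dualMult σ f) ≤ C₁ * wsq (wt ρ 1) f) {l : ℝ} (hl : 0 < l)
    (f : 𝓢(E, ℂ)) :
    wsq (fun x => min l (wt ρ 1 x)) (dualMult σ f)
      ≤ 2 * max C₀ C₁ * wsq (fun x => min l (wt ρ 1 x)) f := by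
  have hw1 : ∀ x : E, wt ρ 1 x = ρ ^ 2 + ‖x‖ ^ 2 := fun x => Real.rpow_one _
  have hw0 : ∀ x : E, wt ρ 0 x = 1 := fun x => Real.rpow_zero _
  have hwp : ∀ x : E, 0 < wt ρ 1 x := fun x => by rw [hw1]; positivity
  set a : E → ℝ := fun x => l * ((l + ρ ^ 2) + ‖x‖ ^ 2)⁻¹ with ha
  have hat : Function.HasTemperateGrowth fun x => ((a x : ℝ) : ℂ) :=
    Function.Complex.hasTemperateGrowth_ofReal.comp ((Function.HasTemperateGrowth.const l).mul
      (hasTemperateGrowth_inv_add_norm_sq (by positivity)))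
  -- `f₁` is concentrated where the weight is below `l`, and `f₀` where it is above.
  set f₁ : 𝓢(E, ℂ) := SchwartzMap.smulLeftCLM ℂ (fun x => ((a x : ℝ) : ℂ)) f with hf₁
  set f₀ := f - f₁ with hf₀
  have hax : ∀ x, a x = l / (l + wt ρ 1 x) := fun x => by
    rw [ha, hw1]; simp only [div_eq_mul_inv]; ring_nf
  have hn₁ : ∀ x, ‖f₁ x‖ ^ 2 = a x ^ 2 * ‖f x‖ ^ 2 := fun x => by
    rw [hf₁, SchwartzMap.smulLeftCLM_apply_apply hat, norm_smul, mul_pow, Complex.norm_real,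
      Real.norm_eq_abs, sq_abs]
  have hn₀ : ∀ x, ‖f₀ x‖ ^ 2 = (1 - a x) ^ 2 * ‖f x‖ ^ 2 := fun x => by
    have : f₀ x = ((1 - a x : ℝ) : ℂ) * f x := by
      rw [hf₀, sub_apply, hf₁, SchwartzMap.smulLeftCLM_apply_apply hat, smul_eq_mul]
      push_cast; ring
    rw [this, norm_mul, mul_pow, Complex.norm_real, Real.norm_eq_abs, sq_abs]
  have hsum : dualMult σ f = dualMult σ f₀ + dualMult σ f₁ := by
    rw [← map_add, hf₀, sub_add_cancel]
  lift l to NNReal using hl.le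
  calc wsq (fun x => min ↑l (wt ρ 1 x)) (dualMult σ f)
      ≤ wsq (fun x => (2 * l : NNReal) * wt ρ 0 x) (dualMult σ f₀)
        + wsq (fun x => (2 : NNReal) * wt ρ 1 x) (dualMult σ f₁) := by
        refine wsq_le_add (by have := measurable_wt (E := E) ρ 0; fun_prop)
          (fun x => mul_nonneg (by positivity) (wt_nonneg _ _ x))
          (fun x => mul_nonneg (by positivity) (wt_nonneg _ _ x)) fun x => ?_
        have h1 := norm_add_sq_le_two_mul (dualMult σ f₀ x) (dualMult σ f₁ x)
        have h2 : min (l : ℝ) (wt ρ 1 x) ≤ l := min_le_left _ _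
        have h3 : min (l : ℝ) (wt ρ 1 x) ≤ wt ρ 1 x := min_le_right _ _
        have h4 : 0 ≤ min (l : ℝ) (wt ρ 1 x) := le_min hl.le (hwp x).le
        rw [hsum, add_apply, hw0]
        push_cast
        calc _ ≤ min (l : ℝ) (wt ρ 1 x) * (2 * ‖dualMult σ f₀ x‖ ^ 2 + 2 * ‖dualMult σ f₁ x‖ ^ 2) := by
              gcongr
          _ = 2 * min (l : ℝ) (wt ρ 1 x) * ‖dualMult σ f₀ x‖ ^ 2
              + 2 * min (l : ℝ) (wt ρ 1 x) * ‖dualMult σ f₁ x‖ ^ 2 := by ring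
          _ ≤ _ := by rw [mul_one]; gcongr
    _ = 2 * l * wsq (wt ρ 0) (dualMult σ f₀) + 2 * wsq (wt ρ 1) (dualMult σ f₁) := by
        rw [wsq_const_mul, wsq_const_mul]; push_cast; rfl
    _ ≤ 2 * l * ((max C₀ C₁ : NNReal) * wsq (wt ρ 0) f₀)
        + 2 * ((max C₀ C₁ : NNReal) * wsq (wt ρ 1) f₁) := by
        refine add_le_add (mul_le_mul_right ((h₀ f₀).trans (mul_le_mul_left ?_ _)) _)
          (mul_le_mul_right ((h₁ f₁).trans (mul_le_mul_left ?_ _)) _)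
        · exact_mod_cast le_max_left _ _
        · exact_mod_cast le_max_right _ _
    _ = 2 * (max C₀ C₁ : NNReal) * (wsq (fun x => l * wt ρ 0 x) f₀ + wsq (wt ρ 1) f₁) := by
        rw [wsq_const_mul]; ring
    _ ≤ 2 * (max C₀ C₁ : NNReal) * wsq (fun x => min ↑l (wt ρ 1 x)) f := by
        refine mul_le_mul_right (add_le_wsq (by have := measurable_wt (E := E) ρ 0; fun_prop)
          (fun x => mul_nonneg (by positivity) (wt_nonneg _ _ x)) (wt_nonneg _ _) fun x => ?_) _
        rw [hn₀, hn₁, hw0, mul_one, ← mul_assoc, ← mul_assoc, ← add_mul]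
        refine mul_le_mul_of_nonneg_right ?_ (by positivity)
        have hp : 0 < (l : ℝ) + wt ρ 1 x := add_pos hl (hwp x)
        have e : (l : ℝ) * (1 - a x) ^ 2 + wt ρ 1 x * a x ^ 2
            = l * wt ρ 1 x / (l + wt ρ 1 x) := by
          rw [hax]; field_simp; ring
        rw [e, le_min_iff, div_le_iff₀ hp, div_le_iff₀ hp]
        constructor <;> nlinarith [mul_pos hl hl, mul_pos (hwp x) (hwp x)]

theorem IsSymbolSpace.weightBound_of_lt_one {S : Set (E → ℂ)} (hS : IsSymbolSpace S) {θ : ℝ}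
    (h0 : 0 < θ) (h1 : θ < 1) : WeightBound S θ := fun g hg => by
  obtain ⟨C₀, hC₀⟩ := hS.weightBound_zero g hg
  obtain ⟨C₁, hC₁⟩ := zero_add (1 : ℝ) ▸ hS.weightBound_add_one hS.weightBound_zero g hg
  refine ⟨2 * max C₀ C₁, fun r ρ hρ hr f => ?_⟩
  set σ : E → ℂ := fun x => g (r • x)
  have hw : ∀ x : E, 0 < wt ρ 1 x := fun x => by unfold wt; positivity
  have hθ : (wt ρ θ : E → ℝ) = fun x => wt ρ 1 x ^ θ := by
    ext x; rw [wt, wt, Real.rpow_one]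
  have hc : 0 < 1 / θ + 1 / (1 - θ) := by
    have : 0 < 1 - θ := by linarith
    positivity
  have hle : ENNReal.ofReal (1 / θ + 1 / (1 - θ)) * wsq (wt ρ θ) (dualMult σ f)
      ≤ ENNReal.ofReal (1 / θ + 1 / (1 - θ)) * ((2 * max C₀ C₁ : NNReal) * wsq (wt ρ θ) f) := by
    rw [mul_left_comm, hθ, ← lintegral_wsq_min h0 h1 (measurable_wt ρ 1) hw,
      ← lintegral_wsq_min h0 h1 (measurable_wt ρ 1) hw, ← lintegral_const_mul' _ _ ENNReal.coe_ne_top]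
    refine setLIntegral_mono_ae' measurableSet_Ioi (ae_of_all _ fun l hl => ?_)
    rw [mul_left_comm]
    refine mul_le_mul_right ?_ _
    push_cast
    exact_mod_cast wsq_min_dualMult_le hρ (hC₀ r ρ hρ hr) (hC₁ r ρ hρ hr) hl f
  exact (ENNReal.mul_le_mul_iff_right (by simpa using hc) ENNReal.ofReal_ne_top).1 hle

theorem IsSymbolSpace.weightBound {S : Set (E → ℂ)} (hS : IsSymbolSpace S) {γ : ℝ}
    (hγ : 0 ≤ γ) : WeightBound S γ := by
  have hn : ∀ (θ : ℝ), 0 ≤ θ → θ < 1 → ∀ n : ℕ, WeightBound S (θ + n) := by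
    intro θ h0 h1 n
    induction n with
    | zero =>
      rw [Nat.cast_zero, add_zero]
      rcases h0.eq_or_lt with rfl | h0
      · exact hS.weightBound_zero
      · exact hS.weightBound_of_lt_one h0 h1
    | succ n ih => rw [Nat.cast_succ, ← add_assoc]; exact hS.weightBound_add_one ih
  have h := hn (Int.fract γ) (Int.fract_nonneg γ) (Int.fract_lt_one γ) ⌊γ⌋₊
  rwa [natCast_floor_eq_intCast_floor hγ, Int.fract_add_floor] at h

end weighted

/-! ### The symbol `cos |ξ|` has bounded derivatives -/

section cosine

/-- A three-term recursion, by one integration by parts in the integral for `s (besselCos (k + 1))'`. -/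
theorem exists_sq_mul_besselCos (k : ℕ) :
    ∃ A B : ℝ, ∀ s, s ^ 2 * besselCos (k + 2) s = A * besselCos (k + 1) s + B * besselCos k s := by
  have hc : besselCoeff (k + 1) ≠ 0 := by
    simp only [besselCoeff]
    have : (k : ℝ) + 1 ≠ 0 := by positivity
    simpa
  have h1 : ∀ s, besselCoeff (k + 1) * (s ^ 2 * besselCos (k + 2) s)
      = -∫ r in (0 : ℝ)..1, (r * (1 - r ^ 2) ^ k) * (Real.sin (r * s) * s) := fun s => by
    have h := (hasDerivAt_besselCos (k + 1) s).unique (hasDerivAt_besselCos_aux k s)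
    calc _ = s * (besselCoeff (k + 1) * (s * besselCos (k + 1 + 1) s)) := by ring
      _ = _ := by
        rw [h, ← intervalIntegral.integral_const_mul, ← intervalIntegral.integral_neg]
        congr 1; ext r; ring
  have hv : ∀ s r : ℝ, HasDerivAt (fun r => -Real.cos (r * s)) (Real.sin (r * s) * s) r := by
    intro s r
    have h : HasDerivAt (fun y => y * s) s r := by simpa using (hasDerivAt_id r).mul_const s
    exact h.cos.neg.congr_deriv (by ring)
  cases k with
  | zero =>
    refine ⟨-1 / besselCoeff 1, 1 / besselCoeff 1, fun s => ?_⟩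
    have key := intervalIntegral.integral_mul_deriv_eq_deriv_mul (a := (0 : ℝ)) (b := 1)
      (u := fun r => r) (u' := fun _ => 1) (fun r _ => hasDerivAt_id r) (fun r _ => hv s r)
      ((by fun_prop : Continuous _).intervalIntegrable _ _)
      ((by fun_prop : Continuous _).intervalIntegrable _ _)
    have := h1 s
    simp only [pow_zero, mul_one] at this
    rw [key] at this
    rw [zero_add] at hc this ⊢
    field_simp
    simp only [besselCos, pow_zero, one_mul]
    simp only [mul_comm (besselCoeff 1), besselCos, pow_one, one_mul, zero_mul, sub_zero,
      intervalIntegral.integral_neg] at this ⊢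
    linarith
  | succ k =>
    refine ⟨-(2 * k + 3) / besselCoeff (k + 2), 2 * (k + 1) / besselCoeff (k + 2), fun s => ?_⟩
    have key := intervalIntegral.integral_mul_deriv_eq_deriv_mul (a := (0 : ℝ)) (b := 1)
      (u := fun r => r * (1 - r ^ 2) ^ (k + 1))
      (u' := fun r => (2 * k + 3) * (1 - r ^ 2) ^ (k + 1) - 2 * (k + 1) * (1 - r ^ 2) ^ k)
      (fun r _ => by
        have h : HasDerivAt (fun y : ℝ => 1 - y ^ 2) (-(2 * r)) r := by
          simpa using (hasDerivAt_pow 2 r).const_sub 1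
        refine HasDerivAt.congr_deriv ((hasDerivAt_id r).mul (h.pow (k + 1))) ?_
        rw [Nat.add_sub_cancel]
        simp only [id]
        push_cast
        ring) (fun r _ => hv s r)
      ((by fun_prop : Continuous _).intervalIntegrable _ _)
      ((by fun_prop : Continuous _).intervalIntegrable _ _)
    have h2 := h1 s
    have e : ∫ r in (0 : ℝ)..1, ((2 * k + 3) * (1 - r ^ 2) ^ (k + 1) - 2 * (k + 1) * (1 - r ^ 2) ^ k)
        * -Real.cos (r * s)
        = -((2 * k + 3) * besselCos (k + 2) s) + 2 * (k + 1) * besselCos (k + 1) s := by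
      simp only [besselCos]
      rw [← intervalIntegral.integral_const_mul, ← intervalIntegral.integral_const_mul,
        ← intervalIntegral.integral_neg, ← intervalIntegral.integral_add
        ((by fun_prop : Continuous _).intervalIntegrable _ _)
        ((by fun_prop : Continuous _).intervalIntegrable _ _)]
      congr 1; ext r; ring
    rw [key, e] at h2
    have hc' : besselCoeff (k + 2) ≠ 0 := hc
    have h3 : besselCoeff (k + 2) * (s ^ 2 * besselCos (k + 3) s)
        = -(2 * k + 3) * besselCos (k + 2) s + 2 * (k + 1) * besselCos (k + 1) s := by
      refine h2.trans ?_
      simp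
      ring
    change s ^ 2 * besselCos (k + 3) s
      = -(2 * k + 3) / besselCoeff (k + 2) * besselCos (k + 2) s + _
    field_simp
    linarith

/-- `besselCos k` decays like `|s|⁻ᵏ`. -/
theorem exists_pow_mul_besselCos_le (k : ℕ) :
    ∃ C : ℝ, ∀ p ≤ k, ∀ s, |s| ^ p * |besselCos k s| ≤ C := by
  suffices h : ∃ C : ℝ, ∀ s, |s| ^ k * |besselCos k s| ≤ C by
    obtain ⟨C, hC⟩ := h
    refine ⟨1 + C, fun p hp s => ?_⟩
    have h1 : |s| ^ p ≤ 1 + |s| ^ k := by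
      rcases le_total |s| 1 with hs | hs
      · exact (pow_le_one₀ (abs_nonneg s) hs).trans (by simp)
      · exact (pow_le_pow_right₀ hs hp).trans (by simp)
    calc _ ≤ (1 + |s| ^ k) * |besselCos k s| := by gcongr
      _ = |besselCos k s| + |s| ^ k * |besselCos k s| := by ring
      _ ≤ _ := add_le_add (abs_besselCos_le k s) (hC s)
  induction k using Nat.twoStepInduction with
  | zero => exact ⟨1, fun s => by simpa using abs_besselCos_le 0 s⟩
  | one =>
    refine ⟨1, fun s => ?_⟩
    have := (hasDerivAt_besselCos 0 s).unique (Real.hasDerivAt_cos s)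
    simp only [besselCoeff, neg_mul, one_mul, neg_inj, zero_add] at this
    rw [pow_one, ← abs_mul, this]
    exact Real.abs_sin_le_one s
  | more k h0 h1 =>
    obtain ⟨C₀, h0⟩ := h0
    obtain ⟨C₁, h1⟩ := h1
    obtain ⟨A, B, h⟩ := exists_sq_mul_besselCos k
    refine ⟨|A| * (1 + C₁) + |B| * C₀, fun s => ?_⟩
    have e : |s| ^ k * |besselCos (k + 1) s| ≤ 1 + C₁ := by
      have hp : |s| ^ k ≤ 1 + |s| ^ (k + 1) := by
        rcases le_total |s| 1 with hs | hs
        · exact (pow_le_one₀ (abs_nonneg s) hs).trans (by simp)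
        · exact (pow_le_pow_right₀ hs k.le_succ).trans (by simp)
      calc _ ≤ (1 + |s| ^ (k + 1)) * |besselCos (k + 1) s| := by gcongr
        _ = |besselCos (k + 1) s| + |s| ^ (k + 1) * |besselCos (k + 1) s| := by ring
        _ ≤ _ := add_le_add (abs_besselCos_le _ s) (h1 s)
    calc |s| ^ (k + 2) * |besselCos (k + 2) s|
        = |s| ^ k * |s ^ 2 * besselCos (k + 2) s| := by
          rw [abs_mul, abs_pow, pow_add, mul_assoc]
      _ ≤ |s| ^ k * (|A| * |besselCos (k + 1) s| + |B| * |besselCos k s|) := by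
          rw [h, ← abs_mul, ← abs_mul]; gcongr; exact abs_add_le _ _
      _ = |A| * (|s| ^ k * |besselCos (k + 1) s|) + |B| * (|s| ^ k * |besselCos k s|) := by ring
      _ ≤ _ := by gcongr; exact h0 s

variable {E : Type*} [NormedAddCommGroup E] [InnerProductSpace ℝ E]

/-- The product of the linear forms `⟨·, e⟩`, `e ∈ l`. -/
def linProd (l : List E) (x : E) : ℝ := (l.map (inner ℝ x)).prod

theorem linProd_cons (e : E) (l : List E) (x : E) :
    linProd (e :: l) x = inner ℝ x e * linProd l x := by simp [linProd]

theorem linProd_append (l l' : List E) (x : E) :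
    linProd (l ++ l') x = linProd l x * linProd l' x := by simp [linProd]

theorem hasTemperateGrowth_linProd (l : List E) : Function.HasTemperateGrowth (linProd l) := by
  induction l with
  | nil =>
    have : (linProd [] : E → ℝ) = fun _ => 1 := by ext; simp [linProd]
    rw [this]; exact .const 1
  | cons e l ih =>
    have : linProd (e :: l) = (fun x => inner ℝ x e) * linProd l := by
      ext x; exact linProd_cons e l x
    rw [this]; exact (Function.hasTemperateGrowth_inner_left e).mul ih

theorem abs_linProd_le (l : List E) : ∃ C : ℝ, 0 ≤ C ∧ ∀ x, |linProd l x| ≤ C * ‖x‖ ^ l.length := by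
  induction l with
  | nil => exact ⟨1, zero_le_one, fun x => by simp [linProd]⟩
  | cons e l ih =>
    obtain ⟨C, hC, h⟩ := ih
    refine ⟨‖e‖ * C, by positivity, fun x => ?_⟩
    rw [linProd_cons, abs_mul]
    calc _ ≤ (‖x‖ * ‖e‖) * (C * ‖x‖ ^ l.length) := by
          gcongr
          · exact abs_real_inner_le_norm x e
          · exact h x
      _ = _ := by rw [List.length_cons]; ring

theorem hasTemperateGrowth_besselCos_norm (k : ℕ) :
    Function.HasTemperateGrowth (fun x : E => besselCos k ‖x‖) := by
  refine ⟨contDiff_infty.2 fun m => contDiff_besselCos_norm m k, fun m => ?_⟩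
  obtain ⟨N, C, -, h⟩ := norm_iteratedFDeriv_besselCos_norm_le (E := E) m k
  exact ⟨N, C, h m le_rfl⟩

variable (E) in
/-- The functions `besselCos k |x|` times at most `k` linear forms. They are bounded, and their
derivatives are linear combinations of functions of this type: differentiating `besselCos k |x|`
gives one more linear form and raises `k` by one. -/
def cosGen : Set (E → ℂ) :=
  {g | ∃ (k : ℕ) (l : List E), l.length ≤ k ∧ g = fun x => ((besselCos k ‖x‖ * linProd l x : ℝ) : ℂ)}

/-- When the linear forms of `l` are differentiated, the list `l'` collects those already passed. -/
theorem besselCos_mul_fderiv_linProd_mem (k : ℕ) (e : E) (l : List E) :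
    ∀ l' : List E, l.length + l'.length ≤ k →
      (fun x => ((besselCos k ‖x‖ * (linProd l' x * fderiv ℝ (linProd l) x e) : ℝ) : ℂ))
        ∈ Algebra.adjoin ℂ (cosGen E) := by
  induction l with
  | nil =>
    intro l' _
    have h1 : (linProd [] : E → ℝ) = fun _ => 1 := by ext; simp [linProd]
    have : (fun x => ((besselCos k ‖x‖ * (linProd l' x * fderiv ℝ (linProd []) x e) : ℝ) : ℂ))
        = 0 := by ext x; simp [h1]
    rw [this]; exact Subalgebra.zero_mem _
  | cons a l ih =>
    intro l' hl
    rw [List.length_cons] at hl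
    have h1 : (fun x => ((besselCos k ‖x‖ * linProd (l' ++ l) x : ℝ) : ℂ)) ∈ cosGen E :=
      ⟨k, _, by rw [List.length_append]; omega, rfl⟩
    have h2 := ih (a :: l') (by rw [List.length_cons]; omega)
    have : (fun x => ((besselCos k ‖x‖ * (linProd l' x * fderiv ℝ (linProd (a :: l)) x e) : ℝ) : ℂ))
        = ((inner ℝ e a : ℝ) : ℂ) • (fun x => ((besselCos k ‖x‖ * linProd (l' ++ l) x : ℝ) : ℂ))
          + fun x => ((besselCos k ‖x‖ * (linProd (a :: l') x * fderiv ℝ (linProd l) x e) : ℝ) : ℂ) := by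
      ext x
      have hl : DifferentiableAt ℝ (linProd l) x :=
        ((hasTemperateGrowth_linProd l).1.differentiable (by simp)) x
      have ha : HasFDerivAt (fun y : E => inner ℝ y a) ((innerSL ℝ).flip a) x :=
        ((innerSL ℝ).flip a).hasFDerivAt
      have hd : fderiv ℝ (linProd (a :: l)) x e
          = inner ℝ x a * fderiv ℝ (linProd l) x e + linProd l x * inner ℝ e a := by
        rw [(ha.mul hl.hasFDerivAt).congr_of_eventuallyEq
          (Filter.Eventually.of_forall fun y => linProd_cons a l y) |>.fderiv]
        simp [innerSL_apply_apply ℝ, real_inner_comm]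
      simp only [hd, linProd_cons, linProd_append, Pi.add_apply, Pi.smul_apply, smul_eq_mul]
      push_cast
      ring
    rw [this]
    exact Subalgebra.add_mem _ (Subalgebra.smul_mem _ (Algebra.subset_adjoin h1) _) h2

variable (E) in
theorem isSymbolSpace_cosGen : IsSymbolSpace (Algebra.adjoin ℂ (cosGen E) : Set (E → ℂ)) := by
  refine isSymbolSpace_adjoin ?_ ?_ ?_
  · rintro _ ⟨k, l, -, rfl⟩
    exact Function.Complex.hasTemperateGrowth_ofReal.comp
      ((hasTemperateGrowth_besselCos_norm k).mul (hasTemperateGrowth_linProd l))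
  · rintro _ ⟨k, l, hl, rfl⟩
    obtain ⟨C, hC⟩ := exists_pow_mul_besselCos_le k
    obtain ⟨D, hD, h⟩ := abs_linProd_le l
    refine ⟨D * C, fun x => ?_⟩
    rw [Complex.norm_real, Real.norm_eq_abs, abs_mul]
    have := hC _ hl ‖x‖
    rw [abs_norm] at this
    calc _ ≤ |besselCos k ‖x‖| * (D * ‖x‖ ^ l.length) := by gcongr; exact h x
      _ = D * (‖x‖ ^ l.length * |besselCos k ‖x‖|) := by ring
      _ ≤ _ := by gcongr
  · rintro _ ⟨k, l, hl, rfl⟩ e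
    have h1 : (fun x => ((besselCos (k + 1) ‖x‖ * linProd (e :: l) x : ℝ) : ℂ)) ∈ cosGen E :=
      ⟨k + 1, e :: l, by rw [List.length_cons]; omega, rfl⟩
    have h2 := besselCos_mul_fderiv_linProd_mem k e l [] (by simpa using hl)
    have : (fun x => fderiv ℝ (fun x : E => ((besselCos k ‖x‖ * linProd l x : ℝ) : ℂ)) x e)
        = (besselCoeff k : ℂ) • (fun x => ((besselCos (k + 1) ‖x‖ * linProd (e :: l) x : ℝ) : ℂ))
          + fun x => ((besselCos k ‖x‖ * (linProd [] x * fderiv ℝ (linProd l) x e) : ℝ) : ℂ) := by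
      ext x
      have hl : DifferentiableAt ℝ (linProd l) x :=
        ((hasTemperateGrowth_linProd l).1.differentiable (by simp)) x
      have hd := ((hasFDerivAt_besselCos_norm k x).mul hl.hasFDerivAt)
      have := (Complex.ofRealCLM.hasFDerivAt.comp x hd).fderiv
      change fderiv ℝ (Complex.ofRealCLM ∘ ((fun x : E => besselCos k ‖x‖) * linProd l)) x e = _
      rw [this]
      simp [linProd]
      ring
    rw [this]
    exact Subalgebra.add_mem _ (Subalgebra.smul_mem _ (Algebra.subset_adjoin h1) _) h2

theorem cos_norm_mem : (fun x : E => ((Real.cos ‖x‖ : ℝ) : ℂ)) ∈ Algebra.adjoin ℂ (cosGen E) :=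
  Algebra.subset_adjoin ⟨0, [], le_rfl, by ext x; simp [linProd, besselCos]⟩

end cosine

/-! ### The symbol `⟨ξ⟩ˢ ⟨(ξ, τ)⟩⁻ˢ` has bounded derivatives -/

section bessel

variable {E F : Type*} [NormedAddCommGroup E] [InnerProductSpace ℝ E]
  [NormedAddCommGroup F] [InnerProductSpace ℝ F]

/-- The function `(1 + |L x|²)ᵖ`. -/
def jap (L : E →L[ℝ] F) (p : ℝ) (x : E) : ℝ := (1 + ‖L x‖ ^ 2) ^ p

theorem hasTemperateGrowth_jap (L : E →L[ℝ] F) (p : ℝ) : Function.HasTemperateGrowth (jap L p) :=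
  (Function.hasTemperateGrowth_one_add_norm_sq_rpow F p).comp L.hasTemperateGrowth

theorem hasFDerivAt_jap (L : E →L[ℝ] F) (p : ℝ) (x : E) :
    HasFDerivAt (jap L p)
      ((2 * p * jap L p x * jap L (-1) x) • ((innerSL ℝ (L x)).comp L)) x := by
  have hp : (0 : ℝ) < 1 + ‖L x‖ ^ 2 := by positivity
  have h1 : HasFDerivAt (fun y => 1 + ‖L y‖ ^ 2) ((2 • innerSL ℝ (L x)).comp L) x :=
    (((hasStrictFDerivAt_norm_sq (L x)).hasFDerivAt).comp x L.hasFDerivAt).const_add 1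
  refine (h1.rpow_const (p := p) (Or.inl hp.ne')).congr_fderiv ?_
  ext v
  simp only [jap, Real.rpow_sub_one hp.ne', Real.rpow_neg_one]
  simp
  ring

theorem jap_neg_one_le_one (L : E →L[ℝ] F) (x : E) : jap L (-1) x ≤ 1 := by
  rw [jap, Real.rpow_neg_one]
  exact inv_le_one_of_one_le₀ (by simp)

/-- The functions `⟨L x⟩⁻²` and `⟨L x, e⟩ ⟨L x⟩⁻²`. -/
def japGen (L : E →L[ℝ] F) : Set (E → ℂ) :=
  insert (fun x => ((jap L (-1) x : ℝ) : ℂ))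
    (Set.range fun e : F => fun x => ((inner ℝ (L x) e * jap L (-1) x : ℝ) : ℂ))

theorem japGen_hasTemperateGrowth (L : E →L[ℝ] F) :
    ∀ g ∈ japGen L, Function.HasTemperateGrowth g := by
  rintro _ (rfl | ⟨e, rfl⟩)
  · exact Function.Complex.hasTemperateGrowth_ofReal.comp (hasTemperateGrowth_jap L _)
  · exact Function.Complex.hasTemperateGrowth_ofReal.comp
      (((Function.hasTemperateGrowth_inner_left e).comp L.hasTemperateGrowth).mul
        (hasTemperateGrowth_jap L _))

theorem japGen_bounded (L : E →L[ℝ] F) : ∀ g ∈ japGen L, ∃ C : ℝ, ∀ x, ‖g x‖ ≤ C := by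
  have h0 : ∀ x, 0 ≤ jap L (-1) x := fun x => by unfold jap; positivity
  rintro _ (rfl | ⟨e, rfl⟩)
  · refine ⟨1, fun x => ?_⟩
    rw [Complex.norm_real, Real.norm_of_nonneg (h0 x)]
    exact jap_neg_one_le_one L x
  · refine ⟨‖e‖, fun x => ?_⟩
    rw [Complex.norm_real, norm_mul, Real.norm_of_nonneg (h0 x), jap, Real.rpow_neg_one,
      ← div_eq_mul_inv, div_le_iff₀ (by positivity)]
    refine (norm_inner_le_norm _ _).trans ?_
    nlinarith [norm_nonneg e, norm_nonneg (L x), mul_nonneg (norm_nonneg e) (sq_nonneg (‖L x‖ - 1)),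
      mul_nonneg (norm_nonneg e) (sq_nonneg ‖L x‖)]

theorem japGen_fderiv_mem (L : E →L[ℝ] F) :
    ∀ g ∈ japGen L, ∀ v, (fun x => fderiv ℝ g x v) ∈ Algebra.adjoin ℂ (japGen L) := by
  have hq : (fun x => ((jap L (-1) x : ℝ) : ℂ)) ∈ Algebra.adjoin ℂ (japGen L) :=
    Algebra.subset_adjoin (Set.mem_insert _ _)
  have hl : ∀ e, (fun x => ((inner ℝ (L x) e * jap L (-1) x : ℝ) : ℂ))
      ∈ Algebra.adjoin ℂ (japGen L) := fun e =>
    Algebra.subset_adjoin (Set.mem_insert_of_mem _ ⟨e, rfl⟩)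
  rintro _ (rfl | ⟨e, rfl⟩) v
  · have : (fun x => fderiv ℝ (fun x => ((jap L (-1) x : ℝ) : ℂ)) x v)
        = (-2 : ℂ) • ((fun x => ((jap L (-1) x : ℝ) : ℂ))
          * fun x => ((inner ℝ (L x) (L v) * jap L (-1) x : ℝ) : ℂ)) := by
      ext x
      have := (Complex.ofRealCLM.hasFDerivAt.comp x (hasFDerivAt_jap L (-1) x)).fderiv
      change fderiv ℝ (Complex.ofRealCLM ∘ jap L (-1)) x v = _
      rw [this]
      simp
      ring
    rw [this]
    exact Subalgebra.smul_mem _ (Subalgebra.mul_mem _ hq (hl _)) _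
  · have : (fun x => fderiv ℝ (fun x => ((inner ℝ (L x) e * jap L (-1) x : ℝ) : ℂ)) x v)
        = ((inner ℝ (L v) e : ℝ) : ℂ) • (fun x => ((jap L (-1) x : ℝ) : ℂ))
          + (-2 : ℂ) • ((fun x => ((inner ℝ (L x) e * jap L (-1) x : ℝ) : ℂ))
          * fun x => ((inner ℝ (L x) (L v) * jap L (-1) x : ℝ) : ℂ)) := by
      ext x
      have ha : HasFDerivAt (fun y : E => inner ℝ (L y) e) (((innerSL ℝ).flip e).comp L) x :=
        (((innerSL ℝ).flip e).comp L).hasFDerivAt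
      have := (Complex.ofRealCLM.hasFDerivAt.comp x (ha.mul (hasFDerivAt_jap L (-1) x))).fderiv
      change fderiv ℝ (Complex.ofRealCLM ∘ ((fun x => inner ℝ (L x) e) * jap L (-1))) x v = _
      rw [this]
      simp [innerSL_apply_apply ℝ, real_inner_comm]
      ring
    rw [this]
    exact Subalgebra.add_mem _ (Subalgebra.smul_mem _ hq _)
      (Subalgebra.smul_mem _ (Subalgebra.mul_mem _ (hl _) (hl _)) _)

/-- The symbol `⟨L x⟩²ᵖ ⟨x⟩⁻²ᵖ`. -/
def japQuot (L : E →L[ℝ] F) (p : ℝ) (x : E) : ℂ :=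
  ((jap L p x * jap (ContinuousLinearMap.id ℝ E) (-p) x : ℝ) : ℂ)

/-- Generators of an algebra of symbols which contains `japQuot L p`. -/
def japQuotGen (L : E →L[ℝ] F) (p : ℝ) : Set (E → ℂ) :=
  insert (japQuot L p) (japGen L ∪ japGen (ContinuousLinearMap.id ℝ E))

theorem isSymbolSpace_japQuotGen {L : E →L[ℝ] F} (hL : ∀ x, ‖L x‖ ≤ ‖x‖) {p : ℝ} (hp : 0 ≤ p) :
    IsSymbolSpace (Algebra.adjoin ℂ (japQuotGen L p) : Set (E → ℂ)) := by
  set I := ContinuousLinearMap.id ℝ E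
  have hmono₁ : Algebra.adjoin ℂ (japGen L) ≤ Algebra.adjoin ℂ (japQuotGen L p) :=
    Algebra.adjoin_mono (Set.subset_union_left.trans (Set.subset_insert _ _))
  have hmono₂ : Algebra.adjoin ℂ (japGen I) ≤ Algebra.adjoin ℂ (japQuotGen L p) :=
    Algebra.adjoin_mono (Set.subset_union_right.trans (Set.subset_insert _ _))
  refine isSymbolSpace_adjoin ?_ ?_ ?_
  · rintro g (rfl | hg | hg)
    · exact Function.Complex.hasTemperateGrowth_ofReal.comp
        ((hasTemperateGrowth_jap L _).mul (hasTemperateGrowth_jap I _))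
    · exact japGen_hasTemperateGrowth L g hg
    · exact japGen_hasTemperateGrowth I g hg
  · rintro g (rfl | hg | hg)
    · refine ⟨1, fun x => ?_⟩
      have h1 : 0 ≤ jap L p x := by unfold jap; positivity
      have h2 : 0 ≤ jap I (-p) x := by unfold jap; positivity
      rw [japQuot, Complex.norm_real, Real.norm_of_nonneg (mul_nonneg h1 h2), jap, jap,
        Real.rpow_neg (by positivity), ← div_eq_mul_inv, div_le_one (by positivity)]
      have := hL x
      refine Real.rpow_le_rpow (by positivity) ?_ hp
      change 1 + ‖L x‖ ^ 2 ≤ 1 + ‖x‖ ^ 2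
      gcongr
    · exact japGen_bounded L g hg
    · exact japGen_bounded I g hg
  · rintro g (rfl | hg | hg) v
    · have hm : japQuot L p ∈ Algebra.adjoin ℂ (japQuotGen L p) :=
        Algebra.subset_adjoin (Set.mem_insert _ _)
      have h1 : (fun x => ((inner ℝ (L x) (L v) * jap L (-1) x : ℝ) : ℂ))
          ∈ Algebra.adjoin ℂ (japQuotGen L p) :=
        hmono₁ (Algebra.subset_adjoin (Set.mem_insert_of_mem _ ⟨L v, rfl⟩))
      have h2 : (fun x => ((inner ℝ (I x) (I v) * jap I (-1) x : ℝ) : ℂ))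
          ∈ Algebra.adjoin ℂ (japQuotGen L p) :=
        hmono₂ (Algebra.subset_adjoin (Set.mem_insert_of_mem _ ⟨I v, rfl⟩))
      have : (fun x => fderiv ℝ (japQuot L p) x v)
          = japQuot L p * ((2 * p : ℂ) • (fun x => ((inner ℝ (L x) (L v) * jap L (-1) x : ℝ) : ℂ))
            - (2 * p : ℂ) • fun x => ((inner ℝ (I x) (I v) * jap I (-1) x : ℝ) : ℂ)) := by
        ext x
        have := (Complex.ofRealCLM.hasFDerivAt.comp x
          ((hasFDerivAt_jap L p x).mul (hasFDerivAt_jap I (-p) x))).fderiv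
        change fderiv ℝ (Complex.ofRealCLM ∘ (jap L p * jap I (-p))) x v = _
        rw [this]
        simp [japQuot, I]
        ring
      rw [this]
      exact Subalgebra.mul_mem _ hm (Subalgebra.sub_mem _ (Subalgebra.smul_mem _ h1 _)
        (Subalgebra.smul_mem _ h2 _))
    · exact hmono₁ (japGen_fderiv_mem L g hg v)
    · exact hmono₂ (japGen_fderiv_mem I g hg v)

end bessel

/-! ### Space-time integrals and time slices of multipliers -/

section slices

variable {n : ℕ}

variable (n) in
/-- The identification of `ℝⁿ × ℝ` with `ℝⁿ⁺¹`. -/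
def spaceTimeEquiv : EuclideanSpace ℝ (Fin n) × ℝ ≃ᵐ EuclideanSpace ℝ (Fin (n + 1)) :=
  ((MeasurableEquiv.toLp 2 (Fin n → ℝ)).symm.prodCongr (MeasurableEquiv.refl ℝ)).trans <|
    MeasurableEquiv.prodComm.trans <|
      (MeasurableEquiv.piFinSuccAbove (fun _ => ℝ) (Fin.last n)).symm.trans
        (MeasurableEquiv.toLp 2 (Fin (n + 1) → ℝ))

theorem spaceTimeEquiv_apply (p : EuclideanSpace ℝ (Fin n) × ℝ) :
    spaceTimeEquiv n p = spaceTime p.1 p.2 := by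
  ext i
  change (Fin.insertNthEquiv (fun _ => ℝ) (Fin.last n)) (p.2, WithLp.ofLp p.1) i = _
  rw [Fin.insertNthEquiv_last]
  rfl

theorem measurePreserving_spaceTimeEquiv : MeasurePreserving (spaceTimeEquiv n) :=
  (PiLp.volume_preserving_toLp (Fin (n + 1))).comp <|
    (volume_preserving_piFinSuccAbove (fun _ => ℝ) (Fin.last n)).symm.comp <|
      (Measure.measurePreserving_swap).comp <|
        (PiLp.volume_preserving_ofLp (Fin n)).prod (MeasurePreserving.id volume)

theorem lintegral_spaceTime {f : EuclideanSpace ℝ (Fin (n + 1)) → ENNReal} (hf : Measurable f) :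
    ∫⁻ y, f y = ∫⁻ t, ∫⁻ x, f (spaceTime x t) := by
  rw [← (measurePreserving_spaceTimeEquiv (n := n)).lintegral_comp hf]
  simp only [spaceTimeEquiv_apply]
  rw [Measure.volume_eq_prod, lintegral_prod_symm]
  have := hf.comp (spaceTimeEquiv n).measurable
  simp only [Function.comp_def, spaceTimeEquiv_apply] at this
  exact this.aemeasurable

theorem integrable_spaceTime {f : EuclideanSpace ℝ (Fin (n + 1)) → ℂ} (hf : Integrable f) :
    Integrable (fun p : EuclideanSpace ℝ (Fin n) × ℝ => f (spaceTime p.1 p.2))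
      (volume.prod volume) := by
  have := (measurePreserving_spaceTimeEquiv (n := n)).integrable_comp_of_integrable hf
  simp only [Function.comp_def, spaceTimeEquiv_apply] at this
  exact this

theorem integral_spaceTime {f : EuclideanSpace ℝ (Fin (n + 1)) → ℂ} (hf : Integrable f) :
    ∫ y, f y = ∫ x, ∫ t, f (spaceTime x t) := by
  rw [← (measurePreserving_spaceTimeEquiv (n := n)).integral_comp
    (spaceTimeEquiv n).measurableEmbedding]
  simp only [spaceTimeEquiv_apply]
  exact integral_prod _ (integrable_spaceTime hf)

theorem inner_spaceTime (x y : EuclideanSpace ℝ (Fin n)) (t s : ℝ) :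
    inner ℝ (spaceTime x t) (spaceTime y s) = inner ℝ x y + t * s := by
  simp [PiLp.inner_apply, Fin.sum_univ_castSucc, spaceTime, mul_comm]

theorem continuous_spaceTime :
    Continuous fun p : EuclideanSpace ℝ (Fin n) × ℝ => spaceTime p.1 p.2 := by
  simp only [spaceTime_eq]
  fun_prop

/-- The Fourier transform of `h (ξ, τ)` in `τ` alone. -/
def timeFourier (h : 𝓢(EuclideanSpace ℝ (Fin (n + 1)), ℂ)) (t : ℝ)
    (ξ : EuclideanSpace ℝ (Fin n)) : ℂ :=
  ∫ τ : ℝ, Real.fourierChar (-(τ * t)) • h (spaceTime ξ τ)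

theorem integrable_fourierChar_smul {X : Type*} [TopologicalSpace X] [MeasurableSpace X]
    [BorelSpace X] {μ : Measure X} {f : X → ℂ} (hf : Integrable f μ) {c : X → ℝ}
    (hc : Continuous c) : Integrable (fun x => Real.fourierChar (c x) • f x) μ := by
  refine (hf.bdd_mul (c := 1) (f := fun x => (Real.fourierChar (c x) : ℂ)) ?_ ?_)
  · have := (continuous_subtype_val.comp (Real.continuous_fourierChar.comp hc))
    exact this.aestronglyMeasurable
  · exact ae_of_all _ fun x => (Circle.norm_coe _).le

/-- The Fourier transform on `ℝⁿ⁺¹` is the one in `τ` followed by the one in `ξ`. -/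
theorem fourier_spaceTime (h : 𝓢(EuclideanSpace ℝ (Fin (n + 1)), ℂ))
    (x : EuclideanSpace ℝ (Fin n)) (t : ℝ) :
    𝓕 h (spaceTime x t) = 𝓕 (timeFourier h t) x := by
  rw [SchwartzMap.fourier_coe, Real.fourier_eq, Real.fourier_eq, integral_spaceTime
    (integrable_fourierChar_smul h.integrable (by fun_prop))]
  refine integral_congr_ae (ae_of_all _ fun ξ => ?_)
  simp only
  rw [timeFourier, Circle.smul_def, ← integral_smul]
  refine integral_congr_ae (ae_of_all _ fun τ => ?_)
  simp only
  rw [inner_spaceTime, neg_add, AddChar.map_add_eq_mul, mul_smul, ← Circle.smul_def]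

theorem integrable_timeFourier (h : 𝓢(EuclideanSpace ℝ (Fin (n + 1)), ℂ)) (t : ℝ) :
    Integrable (timeFourier h t) :=
  (integrable_fourierChar_smul (integrable_spaceTime h.integrable)
    (c := fun p => -(p.2 * t)) (by fun_prop)).integral_prod_left

theorem continuous_timeFourier (h : 𝓢(EuclideanSpace ℝ (Fin (n + 1)), ℂ)) (t : ℝ) :
    Continuous (timeFourier h t) := by
  set C := 2 ^ 2 * (Finset.Iic (2, 0)).sup (fun m => SchwartzMap.seminorm ℂ m.1 m.2) h
  refine continuous_of_dominated (bound := fun τ => C * (1 + τ ^ 2)⁻¹) (fun ξ => ?_) (fun ξ => ?_)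
    (integrable_inv_one_add_sq.const_mul _) (ae_of_all _ fun τ => ?_)
  · have h1 : Continuous fun τ : ℝ => (Real.fourierChar (-(τ * t)) : ℂ) :=
      continuous_subtype_val.comp (Real.continuous_fourierChar.comp (by fun_prop))
    exact (h1.mul (h.continuous.comp (continuous_spaceTime.comp
      (Continuous.prodMk_right ξ)))).aestronglyMeasurable
  · refine ae_of_all _ fun τ => ?_
    rw [Circle.norm_smul, ← div_eq_mul_inv, le_div_iff₀ (by positivity)]
    have h1 := SchwartzMap.one_add_le_sup_seminorm_apply (𝕜 := ℂ) (m := (2, 0)) (k := 2) (n := 0)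
      le_rfl le_rfl h (spaceTime ξ τ)
    rw [norm_iteratedFDeriv_zero] at h1
    refine le_trans ?_ h1
    rw [mul_comm]
    have h2 := abs_le_norm_spaceTime ξ τ
    gcongr
    rw [← sq_abs]
    nlinarith [abs_nonneg τ]
  · exact (h.continuous.comp (continuous_spaceTime.comp
      (Continuous.prodMk_left τ))).const_smul _

/-- Fourier inversion in `x` alone. -/
theorem timeFourier_fourierInv (ψ : 𝓢(EuclideanSpace ℝ (Fin (n + 1)), ℂ)) (t : ℝ) :
    timeFourier (𝓕⁻ ψ) t = 𝓕⁻ (timeSlice t ψ) := by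
  have h1 : 𝓕 (timeFourier (𝓕⁻ ψ) t) = timeSlice t ψ := by
    ext x
    have h := fourier_spaceTime (𝓕⁻ ψ) x t
    rw [FourierTransform.fourier_fourierInv_eq] at h
    exact h.symm
  have h2 := (continuous_timeFourier (𝓕⁻ ψ) t).fourierInv_fourier_eq (integrable_timeFourier _ t)
    (by rw [h1]; exact (timeSlice t ψ).integrable)
  rw [h1] at h2
  rw [SchwartzMap.fourierInv_coe]
  exact h2.symm

/-- A multiplier whose symbol does not depend on `τ` acts on each time slice. -/
theorem timeSlice_dualMult {σ : EuclideanSpace ℝ (Fin n) → ℂ} (hσ : σ.HasTemperateGrowth)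
    (ψ : 𝓢(EuclideanSpace ℝ (Fin (n + 1)), ℂ)) (t : ℝ) :
    timeSlice t (dualMult (σ ∘ spaceProj n) ψ) = dualMult σ (timeSlice t ψ) := by
  have hσ' : Function.HasTemperateGrowth (σ ∘ spaceProj n) :=
    hσ.comp (spaceProj n).hasTemperateGrowth
  ext x
  rw [timeSlice_apply, dualMult_apply, fourier_spaceTime, dualMult_apply, SchwartzMap.fourier_coe]
  refine congrArg (fun g : EuclideanSpace ℝ (Fin n) → ℂ =>
    (𝓕 g : EuclideanSpace ℝ (Fin n) → ℂ) x) (funext fun ξ => ?_)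
  rw [SchwartzMap.smulLeftCLM_apply hσ, ← timeFourier_fourierInv]
  unfold timeFourier
  rw [SchwartzMap.smulLeftCLM_apply hσ']
  simp only [Function.comp_apply, spaceProj_spaceTime]
  rw [← integral_smul]
  refine integral_congr_ae (ae_of_all _ fun τ => ?_)
  exact smul_comm _ _ _

end slices

/-! ### Tempered distributions bounded in the `L²` norm -/

section riesz

variable {E : Type*} [NormedAddCommGroup E] [InnerProductSpace ℝ E] [FiniteDimensional ℝ E]
  [MeasurableSpace E] [BorelSpace E]

/-- The Riesz representation theorem for tempered distributions. -/
theorem exists_toTemperedDistribution_eq (U : 𝓢'(E, ℂ)) {C : ℝ} (hC : 0 ≤ C)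
    (h : ∀ φ : 𝓢(E, ℂ), ‖U φ‖ ≤ C * ‖φ.toLp 2‖) :
    ∃ v : Lp ℂ 2 (volume : Measure E), Lp.toTemperedDistribution v = U ∧ ‖v‖ ≤ C := by
  set e : 𝓢(E, ℂ) →ₗ[ℂ] Lp ℂ 2 (volume : Measure E) :=
    (SchwartzMap.toLpCLM ℂ ℂ 2 volume).toLinearMap
  have hd : DenseRange e := SchwartzMap.denseRange_toLpCLM (by simp)
  set Ul : 𝓢(E, ℂ) →ₗ[ℂ] ℂ :=
    { toFun := fun φ => U φ, map_add' := fun _ _ => map_add _ _ _, map_smul' := fun _ _ => map_smul _ _ _ }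
  -- The representing vector `g` of the extended functional gives `∫ conj g φ`, hence the conjugate.
  set ℓ := Ul.extendOfNorm e
  set g := (InnerProductSpace.toDual ℂ (Lp ℂ 2 (volume : Measure E))).symm ℓ with hg
  have hs := Lp.coeFn_star g
  refine ⟨star g, ?_, ?_⟩
  · ext φ
    rw [Lp.toTemperedDistribution_apply]
    have h1 : ℓ (e φ) = U φ := LinearMap.extendOfNorm_eq (f := Ul) hd ⟨C, h⟩ φ
    rw [← h1, ← InnerProductSpace.toDual_symm_apply, ← hg, L2.inner_def]
    refine integral_congr_ae ?_
    filter_upwards [hs, φ.coeFn_toLp 2 volume] with x hx hx'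
    change _ = inner ℂ (g x) (φ.toLp 2 volume x)
    rw [hx, hx']
    simp
  · have h2 : ‖star g‖ = ‖g‖ := by
      rw [Lp.norm_def, Lp.norm_def]
      congr 1
      refine eLpNorm_congr_norm_ae ?_
      filter_upwards [hs] with x hx
      rw [hx]
      simp
    rw [h2, hg, LinearIsometryEquiv.norm_map]
    exact LinearMap.opNorm_extendOfNorm_le hd hC h

theorem enorm_toLp_two_sq (v : Lp ℂ 2 (volume : Measure E)) :
    ‖v‖ₑ ^ 2 = ∫⁻ x, ‖v x‖ₑ ^ 2 := by
  rw [Lp.enorm_def, eLpNorm_eq_lintegral_rpow_enorm_toReal (by simp) (by simp), ← ENNReal.rpow_natCast,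
    ← ENNReal.rpow_mul]
  simp

theorem enorm_schwartz_toLp_two_sq (φ : 𝓢(E, ℂ)) :
    ‖φ.toLp 2 volume‖ₑ ^ 2 = ∫⁻ x, ‖φ x‖ₑ ^ 2 := by
  rw [enorm_toLp_two_sq]
  refine lintegral_congr_ae ?_
  filter_upwards [φ.coeFn_toLp 2 volume] with x hx
  rw [hx]

end riesz

/-! ### The weighted estimate for `K` -/

section estimate

theorem lintegral_mul_le_sqrt {α : Type*} [MeasurableSpace α] {μ : Measure α} {f g : α → ENNReal}
    (hf : AEMeasurable f μ) (hg : AEMeasurable g μ) :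
    ∫⁻ x, f x * g x ∂μ ≤ (∫⁻ x, f x ^ 2 ∂μ) ^ (1 / 2 : ℝ) * (∫⁻ x, g x ^ 2 ∂μ) ^ (1 / 2 : ℝ) := by
  have := ENNReal.lintegral_mul_le_Lp_mul_Lq μ Real.HolderConjugate.two_two hf hg
  simpa using this

variable {n : ℕ}

/-- The weight at time `t` is the space-time weight. -/
theorem wt_spaceTime (γ t : ℝ) (x : EuclideanSpace ℝ (Fin n)) :
    wt 1 γ (spaceTime x t) = wt √(1 + t ^ 2) γ x := by
  rw [wt, wt, norm_sq_spaceTime, Real.sq_sqrt (by positivity)]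
  congr 1; ring

/-- Integrating over `t ≥ 0` turns the weight `(1 + t² + |x|²)^(a - 1/2)` into a constant times
`⟨x⟩^(2a)`. -/
theorem lintegral_wt_time_le {a : ℝ} (ha : a < 0) (x : EuclideanSpace ℝ (Fin n)) :
    ∫⁻ t in Set.Ici (0 : ℝ), ENNReal.ofReal (wt 1 (-a) x * wt √(1 + t ^ 2) (a - 1 / 2) x)
      ≤ ENNReal.ofReal (1 + 1 / (-2 * a)) := by
  set y := √(1 + ‖x‖ ^ 2) with hy
  have hy2 : y ^ 2 = 1 + ‖x‖ ^ 2 := Real.sq_sqrt (by positivity)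
  have hy0 : 0 < y := Real.sqrt_pos.2 (by positivity)
  have hw1 : wt 1 (-a) x = y ^ (-2 * a) := by
    rw [wt, one_pow, ← hy2, ← Real.rpow_natCast, ← Real.rpow_mul hy0.le]; congr 1; push_cast; ring
  have hw2 : ∀ t : ℝ, wt √(1 + t ^ 2) (a - 1 / 2) x = (t ^ 2 + y ^ 2) ^ (a - 1 / 2) := fun t => by
    rw [wt, Real.sq_sqrt (by positivity), hy2]; congr 1; ring
  have hsq : ∀ s : ℝ, 0 < s → s ^ (2 * a - 1) = (s ^ 2) ^ (a - 1 / 2) := fun s hs => by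
    rw [← Real.rpow_natCast, ← Real.rpow_mul hs.le]; congr 1; push_cast; ring
  have hya : y ^ (-2 * a) * y ^ (2 * a) = 1 := by
    rw [← Real.rpow_add hy0]; simp
  have hyp : 0 < y ^ (-2 * a) := Real.rpow_pos_of_pos hy0 _
  have ha' : 0 < -2 * a := by linarith
  rw [← Set.Icc_union_Ioi_eq_Ici hy0.le, lintegral_union measurableSet_Ioi (by
    rw [Set.disjoint_left]; intro t ht ht'; exact absurd ht.2 (not_le.2 ht')),
    ENNReal.ofReal_add zero_le_one (by positivity)]
  -- The integrand is at most `y⁻¹` for `t ≤ y = ⟨x⟩`, and at most `y^(-2a) t^(2a - 1)` for `t > y`.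
  refine add_le_add ?_ ?_
  · calc _ ≤ ∫⁻ _ in Set.Icc 0 y, ENNReal.ofReal (y ^ (-2 * a) * y ^ (2 * a - 1)) := by
          refine setLIntegral_mono' measurableSet_Icc fun t _ => ENNReal.ofReal_le_ofReal ?_
          rw [hw1, hw2, hsq y hy0]
          refine mul_le_mul_of_nonneg_left (Real.rpow_le_rpow_of_nonpos (by positivity) ?_
            (by linarith)) hyp.le
          nlinarith [sq_nonneg t]
      _ = ENNReal.ofReal 1 := by
          rw [setLIntegral_const, Real.volume_Icc, ← ENNReal.ofReal_mul (by positivity), sub_zero]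
          congr 1
          rw [mul_assoc, ← Real.rpow_add_one hy0.ne', sub_add_cancel, hya]
  · have hi := integrableOn_Ioi_rpow_of_lt (a := 2 * a - 1) (by linarith) hy0
    have hv := integral_Ioi_rpow_of_lt (a := 2 * a - 1) (by linarith) hy0
    calc _ ≤ ∫⁻ t in Set.Ioi y, ENNReal.ofReal (y ^ (-2 * a) * t ^ (2 * a - 1)) := by
          refine setLIntegral_mono' measurableSet_Ioi fun t ht => ENNReal.ofReal_le_ofReal ?_
          have ht0 : 0 < t := hy0.trans ht
          rw [hw1, hw2, hsq t ht0]
          refine mul_le_mul_of_nonneg_left (Real.rpow_le_rpow_of_nonpos (by positivity) ?_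
            (by linarith)) hyp.le
          nlinarith [sq_nonneg y]
      _ = ENNReal.ofReal (1 / (-2 * a)) := by
          rw [← ofReal_integral_eq_lintegral_ofReal (hi.const_mul _)
            ((ae_restrict_iff' measurableSet_Ioi).2 (ae_of_all _ fun t ht =>
              mul_nonneg hyp.le (Real.rpow_nonneg (hy0.trans ht).le _))), integral_const_mul, hv]
          congr 1
          rw [sub_add_cancel, ← mul_div_assoc, mul_neg, hya]
          have : a ≠ 0 := ha.ne
          field_simp

/-- The symbol of `cos (t|D|)` is a rescaled `cos |ξ|`. -/
theorem waveSymbol_eq (t : ℝ) : waveSymbol (n := n) t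
    = fun ξ => (fun η : EuclideanSpace ℝ (Fin n) => ((Real.cos ‖η‖ : ℝ) : ℂ))
      ((2 * Real.pi * t) • ξ) := by
  ext ξ
  have h : |2 * Real.pi * t| * ‖ξ‖ = |t * (2 * Real.pi * ‖ξ‖)| := by
    simp only [abs_mul, abs_norm]; ring
  dsimp only
  rw [waveSymbol, norm_smul, Real.norm_eq_abs, h, Real.cos_abs]

variable (n) in
/-- `cos (t|D|)` is bounded on `L²` with the weight `(1 + t² + |x|²)^γ`, uniformly in `t`. -/
theorem exists_wsq_dualMult_waveSymbol_le {γ : ℝ} (hγ : 0 ≤ γ) :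
    ∃ C : NNReal, ∀ (t : ℝ) (f : 𝓢(EuclideanSpace ℝ (Fin n), ℂ)),
      wsq (wt √(1 + t ^ 2) γ) (dualMult (waveSymbol t) f) ≤ C * wsq (wt √(1 + t ^ 2) γ) f := by
  obtain ⟨C, hC⟩ := (isSymbolSpace_cosGen (EuclideanSpace ℝ (Fin n))).weightBound hγ _ cos_norm_mem
  refine ⟨C, fun t f => ?_⟩
  rw [waveSymbol_eq]
  refine hC _ _ (Real.sqrt_pos.2 (by positivity)) ?_ f
  rw [abs_mul, abs_of_pos (by positivity : 0 < 2 * Real.pi)]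
  gcongr
  exact Real.abs_le_sqrt (by linarith)

/-- The dual estimate: the pairing of `Y₊ cos (t|D|) ⟨x⟩⁻ᵃ v` with a Schwartz function `χ`. The
factor `(1 + t² + |x|²)^γ` is moved through `cos (t|D|)`. -/
theorem lintegral_pairing_le {a : ℝ} (ha : a < 0) {C : NNReal}
    (hC : ∀ (t : ℝ) (f : 𝓢(EuclideanSpace ℝ (Fin n), ℂ)),
      wsq (wt √(1 + t ^ 2) (1 / 2 - a)) (dualMult (waveSymbol t) f)
        ≤ C * wsq (wt √(1 + t ^ 2) (1 / 2 - a)) f)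
    {v : EuclideanSpace ℝ (Fin n) → ℂ} (hv : Measurable v)
    (χ : 𝓢(EuclideanSpace ℝ (Fin (n + 1)), ℂ)) :
    ∫⁻ t in Set.Ici (0 : ℝ), ∫⁻ x, ‖v x‖ₑ * ENNReal.ofReal (wt 1 (-a / 2) x)
        * ‖dualMult (waveSymbol t) (timeSlice t χ) x‖ₑ
      ≤ (ENNReal.ofReal (1 + 1 / (-2 * a)) * ∫⁻ x, ‖v x‖ₑ ^ 2) ^ (1 / 2 : ℝ)
        * (C * wsq (wt 1 (1 / 2 - a)) χ) ^ (1 / 2 : ℝ) := by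
  have hρ : ∀ (t : ℝ) (x : EuclideanSpace ℝ (Fin n)), 0 < √(1 + t ^ 2) ^ 2 + ‖x‖ ^ 2 :=
    fun t x => by rw [Real.sq_sqrt (by positivity)]; positivity
  have hsq : ∀ (ρ γ : ℝ) (x : EuclideanSpace ℝ (Fin n)), wt ρ (γ / 2) x ^ 2 = wt ρ γ x := by
    intro ρ γ x
    rw [wt, wt, ← Real.rpow_natCast, ← Real.rpow_mul (by positivity)]
    congr 1; push_cast; ring
  set A : ℝ → ENNReal := fun t =>
    ∫⁻ x, ‖v x‖ₑ ^ 2 * ENNReal.ofReal (wt 1 (-a) x * wt √(1 + t ^ 2) (a - 1 / 2) x) with hA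
  set B : ℝ → ENNReal := fun t =>
    ∫⁻ x, ENNReal.ofReal (wt 1 (1 / 2 - a) (spaceTime x t) * ‖χ (spaceTime x t)‖ ^ 2) with hB
  have hAm : Measurable (Function.uncurry fun (t : ℝ) (x : EuclideanSpace ℝ (Fin n)) =>
      ‖v x‖ₑ ^ 2 * ENNReal.ofReal (wt 1 (-a) x * wt √(1 + t ^ 2) (a - 1 / 2) x)) := by
    unfold wt; fun_prop
  have hBm : Measurable (Function.uncurry fun (t : ℝ) (x : EuclideanSpace ℝ (Fin n)) =>
      ENNReal.ofReal (wt 1 (1 / 2 - a) (spaceTime x t) * ‖χ (spaceTime x t)‖ ^ 2)) := by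
    have h1 := measurable_wsq_integrand (measurable_wt 1 (1 / 2 - a)) χ
    exact h1.comp (continuous_spaceTime.measurable.comp measurable_swap)
  have hA' : ∫⁻ t in Set.Ici (0 : ℝ), A t
      ≤ ENNReal.ofReal (1 + 1 / (-2 * a)) * ∫⁻ x, ‖v x‖ₑ ^ 2 := by
    rw [hA, lintegral_lintegral_swap hAm.aemeasurable, ← lintegral_const_mul' _ _ (by simp)]
    refine lintegral_mono fun x => ?_
    rw [lintegral_const_mul' _ _ (by simp), mul_comm]
    exact mul_le_mul_left (lintegral_wt_time_le ha x) _
  have hB' : ∫⁻ t in Set.Ici (0 : ℝ), C * B t ≤ C * wsq (wt 1 (1 / 2 - a)) χ := by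
    rw [lintegral_const_mul' _ _ ENNReal.coe_ne_top, wsq,
      lintegral_spaceTime (measurable_wsq_integrand (measurable_wt _ _) _)]
    exact mul_le_mul_right (setLIntegral_le_lintegral _ _) _
  have key : ∀ t : ℝ, ∫⁻ x, ‖v x‖ₑ * ENNReal.ofReal (wt 1 (-a / 2) x)
        * ‖dualMult (waveSymbol t) (timeSlice t χ) x‖ₑ
      ≤ A t ^ (1 / 2 : ℝ) * (C * B t) ^ (1 / 2 : ℝ) := fun t => by
    set F := dualMult (waveSymbol t) (timeSlice t χ)
    have hF := F.continuous.measurable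
    have h1 := lintegral_mul_le_sqrt (μ := volume)
      (f := fun x => ‖v x‖ₑ
        * ENNReal.ofReal (wt 1 (-a / 2) x * wt √(1 + t ^ 2) ((a - 1 / 2) / 2) x))
      (g := fun x => ENNReal.ofReal (wt √(1 + t ^ 2) ((1 / 2 - a) / 2) x) * ‖F x‖ₑ)
      (by unfold wt; fun_prop) (by unfold wt; fun_prop)
    have e1 : ∀ x, (‖v x‖ₑ
        * ENNReal.ofReal (wt 1 (-a / 2) x * wt √(1 + t ^ 2) ((a - 1 / 2) / 2) x))
        * (ENNReal.ofReal (wt √(1 + t ^ 2) ((1 / 2 - a) / 2) x) * ‖F x‖ₑ)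
        = ‖v x‖ₑ * ENNReal.ofReal (wt 1 (-a / 2) x) * ‖F x‖ₑ := fun x => by
      have e : wt √(1 + t ^ 2) ((a - 1 / 2) / 2) x * wt √(1 + t ^ 2) ((1 / 2 - a) / 2) x = 1 := by
        rw [wt, wt, ← Real.rpow_add (hρ t x)]
        ring_nf
        exact Real.rpow_zero _
      rw [ENNReal.ofReal_mul (wt_nonneg _ _ x)]
      calc _ = ‖v x‖ₑ * ENNReal.ofReal (wt 1 (-a / 2) x) * ‖F x‖ₑ *
            (ENNReal.ofReal (wt √(1 + t ^ 2) ((a - 1 / 2) / 2) x)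
              * ENNReal.ofReal (wt √(1 + t ^ 2) ((1 / 2 - a) / 2) x)) := by ring
        _ = _ := by rw [← ENNReal.ofReal_mul (wt_nonneg _ _ x), e, ENNReal.ofReal_one, mul_one]
    have e2 : ∀ x, (‖v x‖ₑ
        * ENNReal.ofReal (wt 1 (-a / 2) x * wt √(1 + t ^ 2) ((a - 1 / 2) / 2) x)) ^ 2
        = ‖v x‖ₑ ^ 2 * ENNReal.ofReal (wt 1 (-a) x * wt √(1 + t ^ 2) (a - 1 / 2) x) := fun x => by
      rw [mul_pow, ← ENNReal.ofReal_pow (mul_nonneg (wt_nonneg _ _ x) (wt_nonneg _ _ x)), mul_pow,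
        hsq, hsq]
    have e3 : ∀ x, (ENNReal.ofReal (wt √(1 + t ^ 2) ((1 / 2 - a) / 2) x) * ‖F x‖ₑ) ^ 2
        = ENNReal.ofReal (wt √(1 + t ^ 2) (1 / 2 - a) x * ‖F x‖ ^ 2) := fun x => by
      rw [← ofReal_norm, ← ENNReal.ofReal_mul (wt_nonneg _ _ x),
        ← ENNReal.ofReal_pow (mul_nonneg (wt_nonneg _ _ x) (norm_nonneg _)), mul_pow, hsq]
    simp only [e1, e2, e3] at h1
    refine h1.trans (mul_le_mul_right (ENNReal.rpow_le_rpow ?_ (by norm_num)) _)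
    refine (hC t (timeSlice t χ)).trans (le_of_eq ?_)
    simp only [hB, wsq, wt_spaceTime, timeSlice_apply]
  have hA1 : Measurable A := hAm.lintegral_prod_right
  have hB1 : Measurable B := hBm.lintegral_prod_right
  clear_value A B
  calc _ ≤ ∫⁻ t in Set.Ici (0 : ℝ), A t ^ (1 / 2 : ℝ) * (C * B t) ^ (1 / 2 : ℝ) :=
        lintegral_mono fun t => key t
    _ ≤ (∫⁻ t in Set.Ici (0 : ℝ), A t) ^ (1 / 2 : ℝ)
        * (∫⁻ t in Set.Ici (0 : ℝ), C * B t) ^ (1 / 2 : ℝ) := by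
        have e : ∀ z : ENNReal, (z ^ (1 / 2 : ℝ)) ^ 2 = z := fun z => by
          rw [← ENNReal.rpow_natCast, ← ENNReal.rpow_mul]; simp
        have h1 := lintegral_mul_le_sqrt (μ := volume.restrict (Set.Ici (0 : ℝ)))
          (f := fun t => A t ^ (1 / 2 : ℝ)) (g := fun t => (C * B t) ^ (1 / 2 : ℝ))
          (hA1.pow_const _).aemeasurable ((hB1.const_mul _).pow_const _).aemeasurable
        simpa only [e] using h1
    _ ≤ _ := by gcongr

end estimate

/-! ### Boundedness of `K` -/

section main

variable {n : ℕ}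

theorem weightOp_apply (d : ℕ) (a b : ℝ) (u : 𝓢'(EuclideanSpace ℝ (Fin d), ℂ))
    (φ : 𝓢(EuclideanSpace ℝ (Fin d), ℂ)) :
    weightOp d a b u φ = u (dualMult (fun ξ => bracket d b ((2 * Real.pi) • ξ))
      (SchwartzMap.smulLeftCLM ℂ (bracket d a) φ)) := rfl

theorem cosD_eq_dualMult (t : ℝ) (u : 𝓢'(EuclideanSpace ℝ (Fin n), ℂ))
    (g : 𝓢(EuclideanSpace ℝ (Fin n), ℂ)) : cosD n t u g = u (dualMult (waveSymbol t) g) := rfl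

theorem bracket_eq_jap (d : ℕ) (a : ℝ) (x : EuclideanSpace ℝ (Fin d)) :
    bracket d a x = ((jap (ContinuousLinearMap.id ℝ (EuclideanSpace ℝ (Fin d))) (a / 2) x : ℝ) : ℂ) :=
  rfl

/-- If `⟨x⟩ᵃ ⟨D⟩ᵇ u = v` then `u = ⟨D⟩⁻ᵇ ⟨x⟩⁻ᵃ v`. -/
theorem eq_integral_of_weightOp_eq {d : ℕ} {a b : ℝ} {u : 𝓢'(EuclideanSpace ℝ (Fin d), ℂ)}
    {v : Lp ℂ 2 (volume : Measure (EuclideanSpace ℝ (Fin d)))}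
    (h : Lp.toTemperedDistribution v = weightOp d a b u) (g : 𝓢(EuclideanSpace ℝ (Fin d), ℂ)) :
    u g = ∫ x, (bracket d (-a) x
      * dualMult (fun ξ => bracket d (-b) ((2 * Real.pi) • ξ)) g x) * v x := by
  set G := dualMult (fun ξ => bracket d (-b) ((2 * Real.pi) • ξ)) g with hG
  have h1 : SchwartzMap.smulLeftCLM ℂ (bracket d a) (SchwartzMap.smulLeftCLM ℂ (bracket d (-a)) G)
      = G := by
    rw [SchwartzMap.smulLeftCLM_smulLeftCLM_apply (hasTemperateGrowth_bracket d _)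
      (hasTemperateGrowth_bracket d _)]
    have : bracket d a * bracket d (-a) = fun _ => 1 :=
      funext fun x => bracket_mul_bracket_neg d a x
    rw [this]; simp
  have h2 : dualMult (fun ξ => bracket d b ((2 * Real.pi) • ξ)) G = g := by
    rw [hG, dualMult_dualMult (hasTemperateGrowth_bracket_two_pi d _)
      (hasTemperateGrowth_bracket_two_pi d _)]
    have : ((fun ξ => bracket d b ((2 * Real.pi) • ξ)) * fun ξ => bracket d (-b) ((2 * Real.pi) • ξ))
        = fun _ => 1 := funext fun x => bracket_mul_bracket_neg d b _
    rw [this, dualMult_apply]; simp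
  have h3 := congrArg (fun U : 𝓢'(EuclideanSpace ℝ (Fin d), ℂ) =>
    U (SchwartzMap.smulLeftCLM ℂ (bracket d (-a)) G)) h
  simp only [weightOp_apply, h1, h2] at h3
  rw [← h3, Lp.toTemperedDistribution_apply]
  simp [SchwartzMap.smulLeftCLM_apply_apply (hasTemperateGrowth_bracket d (-a))]

variable (n) in
/-- Passing from `⟨D⟩ᵇ` on `ℝⁿ⁺¹` to `⟨D_x⟩ᵇ` costs a multiplier with bounded derivatives, as
`b ≤ 0`. -/
theorem exists_wsq_bracket_le {a b : ℝ} (ha : a < 0) (hb : b ≤ 0) :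
    ∃ C : NNReal, ∀ φ : 𝓢(EuclideanSpace ℝ (Fin (n + 1)), ℂ),
      wsq (wt 1 (1 / 2 - a)) (dualMult ((fun ξ => bracket n (-b) ((2 * Real.pi) • ξ)) ∘ spaceProj n)
        (dualMult (fun ξ => bracket (n + 1) b ((2 * Real.pi) • ξ))
          (SchwartzMap.smulLeftCLM ℂ (bracket (n + 1) (a - 1 / 2)) φ)))
      ≤ C * ‖φ.toLp 2 volume‖ₑ ^ 2 := by
  have hL : ∀ x : EuclideanSpace ℝ (Fin (n + 1)), ‖spaceProj n x‖ ≤ ‖x‖ := fun x => by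
    rw [EuclideanSpace.norm_eq, EuclideanSpace.norm_eq]
    refine Real.sqrt_le_sqrt ?_
    rw [Fin.sum_univ_castSucc]
    exact le_add_of_nonneg_right (by positivity)
  obtain ⟨C, hC⟩ := (isSymbolSpace_japQuotGen hL (p := -b / 2) (by linarith)).weightBound
    (γ := 1 / 2 - a) (by linarith) _ (Algebra.subset_adjoin (Set.mem_insert _ _))
  refine ⟨C, fun φ => ?_⟩
  set Φ := SchwartzMap.smulLeftCLM ℂ (bracket (n + 1) (a - 1 / 2)) φ with hΦ
  have hσ : ((fun ξ => bracket n (-b) ((2 * Real.pi) • ξ)) ∘ spaceProj n)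
      * (fun ξ => bracket (n + 1) b ((2 * Real.pi) • ξ))
      = fun ξ => japQuot (spaceProj n) (-b / 2) ((2 * Real.pi) • ξ) := by
    ext ξ
    rw [japQuot, Complex.ofReal_mul, neg_div, neg_neg, ← bracket_eq_jap, ← neg_div]
    simp only [Pi.mul_apply, Function.comp_apply, jap, map_smul]
    rfl
  rw [dualMult_dualMult ((hasTemperateGrowth_bracket_two_pi n _).comp
    (spaceProj n).hasTemperateGrowth) (hasTemperateGrowth_bracket_two_pi _ _), hσ]
  refine (hC (2 * Real.pi) 1 one_pos (by rw [mul_one, abs_of_pos (by positivity)]) Φ).trans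
    (le_of_eq ?_)
  congr 1
  rw [enorm_schwartz_toLp_two_sq, wsq]
  refine lintegral_congr fun x => ?_
  rw [← ofReal_norm, ← ENNReal.ofReal_pow (norm_nonneg _), hΦ,
    SchwartzMap.smulLeftCLM_apply_apply (hasTemperateGrowth_bracket _ _), norm_smul, mul_pow,
    bracket, Complex.norm_real, Real.norm_of_nonneg (by positivity), wt, one_pow, ← mul_assoc,
    ← Real.rpow_natCast ((1 + ‖x‖ ^ 2) ^ ((a - 1 / 2) / 2)), ← Real.rpow_mul (by positivity),
    ← Real.rpow_add (by positivity)]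
  have : 1 / 2 - a + (a - 1 / 2) / 2 * ((2 : ℕ) : ℝ) = 0 := by push_cast; ring
  rw [this, Real.rpow_zero, one_mul]

variable (n) in
/-- `⟨X⟩^(a - 1/2) ⟨D⟩ᵇ K u` is bounded in the `L²` norm by the norm of `u`. -/
theorem exists_norm_weightOp_waveK_le {a b : ℝ} (ha : a < 0) (hb : b ≤ 0) :
    ∃ C : ℝ, 0 ≤ C ∧ ∀ (u : WeightedSobolev n a b) (φ : 𝓢(EuclideanSpace ℝ (Fin (n + 1)), ℂ)),
      ‖weightOp (n + 1) (a - 1 / 2) b (waveK n u.toDist) φ‖ ≤ C * ‖u‖ * ‖φ.toLp 2 volume‖ := by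
  obtain ⟨C₁, hC₁⟩ := exists_wsq_dualMult_waveSymbol_le n (γ := 1 / 2 - a) (by linarith)
  obtain ⟨C₂, hC₂⟩ := exists_wsq_bracket_le n ha hb
  set K : NNReal := (1 + 1 / (-2 * a)).toNNReal
  refine ⟨√K * √(C₁ * C₂), by positivity, fun u φ => ?_⟩
  set v := WeightedSobolev.toL2 u with hv
  set ψ := dualMult (fun ξ => bracket (n + 1) b ((2 * Real.pi) • ξ))
    (SchwartzMap.smulLeftCLM ℂ (bracket (n + 1) (a - 1 / 2)) φ) with hψ
  set σ : EuclideanSpace ℝ (Fin n) → ℂ := fun ξ => bracket n (-b) ((2 * Real.pi) • ξ) with hσ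
  have hσt : σ.HasTemperateGrowth := hasTemperateGrowth_bracket_two_pi n _
  set χ := dualMult (σ ∘ spaceProj n) ψ with hχ
  have e : ∀ t, cosD n t u.toDist (timeSlice t ψ) = ∫ x, (bracket n (-a) x
      * dualMult (waveSymbol t) (timeSlice t χ) x) * v x := fun t => by
    rw [cosD_eq_dualMult, eq_integral_of_weightOp_eq (WeightedSobolev.coe_toL2 u), ← hσ,
      dualMult_dualMult hσt (hasTemperateGrowth_waveSymbol t), mul_comm σ,
      ← dualMult_dualMult (hasTemperateGrowth_waveSymbol t) hσt, ← timeSlice_dualMult hσt]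
  have hle : ‖weightOp (n + 1) (a - 1 / 2) b (waveK n u.toDist) φ‖ₑ
      ≤ (K * ‖v‖ₑ ^ 2) ^ (1 / 2 : ℝ) * (C₁ * (C₂ * ‖φ.toLp 2 volume‖ₑ ^ 2)) ^ (1 / 2 : ℝ) := by
    rw [weightOp_apply, ← hψ, waveK_apply]
    simp only [e]
    calc _ ≤ ∫⁻ t in Set.Ici (0 : ℝ), ∫⁻ x, ‖v x‖ₑ * ENNReal.ofReal (wt 1 (-a / 2) x)
          * ‖dualMult (waveSymbol t) (timeSlice t χ) x‖ₑ := by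
          refine (enorm_integral_le_lintegral_enorm _).trans (lintegral_mono fun t => ?_)
          refine (enorm_integral_le_lintegral_enorm _).trans (lintegral_mono fun x => ?_)
          have hb : ‖bracket n (-a) x‖ₑ = ENNReal.ofReal (wt 1 (-a / 2) x) := by
            rw [← ofReal_norm, bracket, Complex.norm_real, Real.norm_of_nonneg (by positivity), wt,
              one_pow]
          rw [enorm_mul, enorm_mul, hb]
          exact le_of_eq (by ring)
      _ ≤ _ := lintegral_pairing_le ha hC₁ (Lp.stronglyMeasurable v).measurable χ
      _ ≤ _ := by
          rw [← enorm_toLp_two_sq]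
          refine mul_le_mul_right (ENNReal.rpow_le_rpow ?_ (by norm_num)) _
          exact mul_le_mul_right (hC₂ φ) _
  have hsq : ∀ (c : NNReal) (z : ENNReal),
      (c * z ^ 2) ^ (1 / 2 : ℝ) = ENNReal.ofReal √c * z := fun c z => by
    rw [ENNReal.mul_rpow_of_nonneg _ _ (by norm_num), ← ENNReal.rpow_natCast z, ← ENNReal.rpow_mul,
      Real.sqrt_eq_rpow, ← ENNReal.ofReal_rpow_of_nonneg c.coe_nonneg (by norm_num),
      ENNReal.ofReal_coe_nnreal]
    simp
  rw [← mul_assoc, ← ENNReal.coe_mul, hsq, hsq, ← ofReal_norm, ← ofReal_norm v, ← ofReal_norm,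
    ← ENNReal.ofReal_mul (by positivity), ← ENNReal.ofReal_mul (by positivity),
    ← ENNReal.ofReal_mul (by positivity), ENNReal.ofReal_le_ofReal_iff (by positivity)] at hle
  rw [WeightedSobolev.norm_eq, ← hv]
  refine hle.trans (le_of_eq ?_)
  push_cast
  ring

end main

end
end WaveK

theorem mainTheorem4 (n : ℕ) (hn : Odd n) (a b : ℝ) (ha : a < 0) (hb : b ≤ 0) :
    ∃ T : WaveK.WeightedSobolev n a b →L[ℂ] WaveK.WeightedSobolev (n + 1) (a - 1 / 2) b,
      ∀ u : WaveK.WeightedSobolev n a b, (T u).toDist = WaveK.waveK n u.toDist := by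
  obtain ⟨C, hC, h⟩ := WaveK.exists_norm_weightOp_waveK_le n ha hb
  choose w hw hwC using fun u : WaveK.WeightedSobolev n a b =>
    WaveK.exists_toTemperedDistribution_eq _ (by positivity) (h u)
  let T : WaveK.WeightedSobolev n a b →ₗ[ℂ] WaveK.WeightedSobolev (n + 1) (a - 1 / 2) b :=
    ((WaveK.waveK n).comp WaveK.WeightedSobolev.toDist).codRestrict
      (WaveK.weightedSobolevSubmodule (n + 1) (a - 1 / 2) b) fun u => ⟨w u, hw u⟩
  refine ⟨T.mkContinuous C fun u => ?_, fun u => rfl⟩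
  have e : WaveK.WeightedSobolev.toL2 (T u) = w u :=
    WaveK.toTemperedDistribution_injective (n + 1)
      ((WaveK.WeightedSobolev.coe_toL2 (T u)).trans (hw u).symm)
  rw [WaveK.WeightedSobolev.norm_eq, e]
  exact hwC u
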